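/- Let $\alpha,\lambda_0,\beta,\ell\in\mathbb R$ and let $\nu$ be a probability distribution on $\mathbb R$; write $X$ for a random variable with law $\nu$. Let $(\Omega,\mathcal F,(\mathcal F_t)_{t\ge 0},P)$ be a filtered probability space carrying event times $0\le T_1\le T_2\le\cdots\le\infty$ that are stopping times, almost surely $T_n<T_{n+1}$ whenever $T_n<\infty$, with counting process $N(t)=\sum_{n\ge1}1_{\{T_n\le t\}}$, almost surely finite for all $t$; jump sizes $X_1,X_2,\dots$; and a real-valued process $\lambda(t)$, such that: 1. $\lambda(t)$ is the intensity of $N$: it is nonnegative (almost surely), adapted, has càdlàg paths, and $E\left[\int_0^\infty f(s)\,dN(s)\right]=E\left[\int_0^\infty f(s)\lambda(s)\,ds\right]$ for every nonnegative predictable process $f$; 2. the jump sizes are independent of the current value of the intensity: on $\{T_k<\infty\}$, $X_k$ is known at time $T_k$ and, conditionally on the strict past $\mathcal F_{T_k-}$, has law $\nu$; 3. with $U(t)=\sum_{k=1}^{N(t)}X_k$, almost surely for all $t\ge0$, $$\lambda(t)=\ell+\int_0^t\alpha(\lambda_0-\lambda(s))\,ds+\beta U(t),$$ that is, $d\lambda=\alpha(\lambda_0-\lambda)\,dt+\beta\,dU$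 and $\lambda(0)=\ell$. Assume $E|X|<\infty$, put $\rho=\beta E[X]-\alpha$ and assume $\rho\ne0$. Let $$m_0=-\frac{\alpha\lambda_0}{\rho},\qquad m_1=\frac{\alpha\lambda_0}{\rho}+\ell .$$ Then for every $t\ge0$ the variable $\lambda(t)$ is integrable and $$E[\lambda(t)]=m_0+m_1e^{\rho t}.$$ If moreover $E[X^2]<\infty$, put $A=2\alpha\lambda_0+\beta^2E[X^2]$ and $$v_0=\frac{A\alpha\lambda_0}{2\rho^2},\qquad v_1=-\frac A\rho\Big(\frac{\alpha\lambda_0}{\rho}+\ell\Big),\qquad v_2=\frac{A}{2\rho^2}(\alpha\lambda_0+2\rho\ell)+\ell^2 .$$ Then for every $t\ge0$ the variable $\lambda(t)$ and the integrated intensity $\Lambda(t)=\int_0^t\lambda(s)\,ds$ are square integrable, and $$E[\lambda^2(t)]=v_0+v_1e^{\rho t}+v_2e^{2\rho t},$$ $$E[\Lambda^2(t)]=k_0+k_1t+k_2t^2+(C_0+C_1t)e^{\rho t}+C_2e^{2\rho t},$$ where $$k_0=\frac{2m_0(m_0-2m_1)-2v_0+2v_1+v_2}{\rho^2},\qquad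 k_1=\frac{2m_0(m_0-m_1)-2v_0}{\rho},\qquad k_2=m_0^2,$$ $$C_0=\frac{2\big(m_0(2m_1-m_0)+v_0-v_1-v_2\big)}{\rho^2},\qquad C_1=\frac{2(v_1-m_0m_1)}{\rho},\qquad C_2=\frac{v_2}{\rho^2}.$$ -/

import Mathlib

open MeasureTheory Filter Topology Set
open scoped NNReal ENNReal

namespace SelfExciting

variable {Ω : Type*} {mΩ : MeasurableSpace Ω}

/-- The σ-algebra `𝓕_{τ-}` of the strict past of a random time `τ`: it is generated by `𝓕_0` and by
the sets `A ∩ {t < τ}` with `A ∈ 𝓕_t`, `t ≥ 0`. -/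
@[reducible]
def strictPast (𝓕 : Filtration ℝ≥0 mΩ) (τ : Ω → WithTop ℝ≥0) : MeasurableSpace Ω :=
  MeasurableSpace.generateFrom
    ({B | MeasurableSet[𝓕 0] B} ∪
      {B | ∃ (t : ℝ≥0) (A : Set Ω), MeasurableSet[𝓕 t] A ∧ B = A ∩ {ω | (t : WithTop ℝ≥0) < τ ω}})

/-- The counting process `N(t) = ∑_{n} 1_{T_n ≤ t}`. The points are indexed from `0`, so that
`T 0, T 1, …` are the first, second, … event times; `T n ω = ⊤` means that there are at most `n`
events. -/
noncomputable def count (T : ℕ → Ω → WithTop ℝ≥0) (t : ℝ≥0) (ω : Ω) : ℕ :=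
  {n : ℕ | T n ω ≤ (t : WithTop ℝ≥0)}.ncard

/-- The jump process `U(t) = ∑_{k=1}^{N(t)} X_k`. -/
noncomputable def jumpProcess (T : ℕ → Ω → WithTop ℝ≥0) (X : ℕ → Ω → ℝ) (t : ℝ≥0) (ω : Ω) : ℝ :=
  ∑ k ∈ Finset.range (count T t ω), X k ω

/-- The integral `∫_0^∞ f(s) dN(s) = ∑_{n : T_n < ∞} f(T_n)` of a nonnegative process. -/
noncomputable def integralCount (T : ℕ → Ω → WithTop ℝ≥0) (f : ℝ≥0 × Ω → ℝ≥0∞) (ω : Ω) : ℝ≥0∞ :=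
  ∑' n : ℕ, if T n ω < ⊤ then f ((T n ω).untopD 0, ω) else 0

/-- `T` is an `𝓕`-adapted point process on `[0, ∞)`: the event times are nondecreasing stopping
times, almost surely strictly increasing as long as they are finite (no two events at the same
time), and almost surely there are only finitely many events in each bounded time interval. -/
structure IsPointProcess (P : Measure Ω) (𝓕 : Filtration ℝ≥0 mΩ)
    (T : ℕ → Ω → WithTop ℝ≥0) : Prop where
  isStoppingTime : ∀ n, IsStoppingTime 𝓕 (T n)
  monotone : ∀ ω, Monotone fun n => T n ω
  simple : ∀ᵐ ω ∂P, ∀ n, T n ω < ⊤ → T n ω < T (n + 1) ω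
  finite : ∀ᵐ ω ∂P, ∀ t : ℝ≥0, {n : ℕ | T n ω ≤ (t : WithTop ℝ≥0)}.Finite

/-- `lam` is the `𝓕`-intensity of the point process `T`: a nonnegative adapted process with càdlàg
paths such that `E[∫_0^∞ f(s) dN(s)] = E[∫_0^∞ f(s) λ(s) ds]` for all nonnegative predictable
`f`. -/
structure IsIntensity (P : Measure Ω) (𝓕 : Filtration ℝ≥0 mΩ)
    (T : ℕ → Ω → WithTop ℝ≥0) (lam : ℝ≥0 → Ω → ℝ) : Prop where
  adapted : Adapted 𝓕 lam
  rightContinuous : ∀ ω t, ContinuousWithinAt (fun s => lam s ω) (Ici t) t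
  leftLimits : ∀ ω t, ∃ l : ℝ, Tendsto (fun s => lam s ω) (𝓝[<] t) (𝓝 l)
  nonneg : ∀ᵐ ω ∂P, ∀ t, 0 ≤ lam t ω
  lintegral_eq : ∀ f : ℝ≥0 × Ω → ℝ≥0∞, Measurable[𝓕.predictable] f →
    ∫⁻ ω, integralCount T f ω ∂P =
      ∫⁻ ω, (∫⁻ s in Ioi (0 : ℝ),
        f (s.toNNReal, ω) * ENNReal.ofReal (lam s.toNNReal ω)) ∂P

/-- `X` is a sequence of jump sizes attached to the event times `T`, with a jump size distribution
`ν` that does not depend on the intensity: `X n` is known at time `T n`, and given the strict past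
of `T n` (on `T n < ∞`) it has the law `ν`. -/
structure HasJumpLaw (P : Measure Ω) (𝓕 : Filtration ℝ≥0 mΩ)
    (T : ℕ → Ω → WithTop ℝ≥0) (X : ℕ → Ω → ℝ) (ν : Measure ℝ) : Prop where
  measurable : ∀ n, Measurable (X n)
  adapted : ∀ (n : ℕ) (t : ℝ≥0) (C : Set ℝ), MeasurableSet C →
    MeasurableSet[𝓕 t] (X n ⁻¹' C ∩ {ω | T n ω ≤ (t : WithTop ℝ≥0)})
  law : ∀ (n : ℕ) (B : Set Ω) (C : Set ℝ),
    MeasurableSet[strictPast 𝓕 (T n)] B → MeasurableSet C →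
    P (B ∩ {ω | T n ω < ⊤} ∩ X n ⁻¹' C) = P (B ∩ {ω | T n ω < ⊤}) * ν C

/-- The SDE-driven self-exciting jump process with linear intensity
`dλ(t) = α (λ₀ - λ(t)) dt + β dU(t)`, `λ(0) = init`, where `U(t) = ∑_{k=1}^{N(t)} X_k`, the process
`λ` is the intensity of the counting process `N` of the event times `T`, and the jump sizes `X` have
the distribution `ν` whatever the value of the intensity. -/
structure IsLinearSelfExciting (P : Measure Ω) (𝓕 : Filtration ℝ≥0 mΩ)
    (α lam₀ β init : ℝ) (ν : Measure ℝ)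
    (T : ℕ → Ω → WithTop ℝ≥0) (X : ℕ → Ω → ℝ) (lam : ℝ≥0 → Ω → ℝ) : Prop where
  pointProcess : IsPointProcess P 𝓕 T
  jumpLaw : HasJumpLaw P 𝓕 T X ν
  intensity : IsIntensity P 𝓕 T lam
  sde : ∀ᵐ ω ∂P, ∀ t : ℝ≥0,
    lam t ω = init + (∫ s in (0 : ℝ)..t, α * (lam₀ - lam s.toNNReal ω)) + β * jumpProcess T X t ω

/-- The integrated intensity `Λ(t) = ∫_0^t λ(s) ds`. -/
noncomputable def integratedIntensity (lam : ℝ≥0 → Ω → ℝ) (t : ℝ≥0) (ω : Ω) : ℝ :=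
  ∫ s in (0 : ℝ)..t, lam s.toNNReal ω

end SelfExciting

/-!
The moments solve scalar linear integral equations, because the intensity of the counting process is
the process itself.

Two facts carry the proof. The first is the compensation formula (`integral_tsum_atEvent_mul`):
for a predictable `f` and a function `φ` of the jump size, `E ∑ₙ f(Tₙ) φ(Xₙ) = ∫ φ dν · E ∫ f λ
ds`. It combines the defining property of the intensity with the jump law, since `f(Tₙ)` is known
in the strict past of `Tₙ` (`measurable_predictable_comp_strictPast`). The second is the product
rule along a path with finitely many jumps (`primitive_mul_path`, `path_sq`), which writes `λ(t)²`
and `Λ(t) λ(t)` as a time integral plus a sum over the events of a predictable process times a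
power of the jump size. For `λ²` that predictable process is the left limit `λ(s-)`, encoded as
`leftIntensity`. It agrees with `λ` at almost every time, which closes the equations:

* `E λ(t) = ℓ + ∫₀ᵗ (α λ₀ + ρ E λ) ds`,
* `E λ(t)² = ℓ² + ∫₀ᵗ (A E λ + 2 ρ E λ²) ds`,
* `E Λ(t) λ(t) = ∫₀ᵗ (E λ² + α λ₀ E Λ + ρ E Λ λ) ds`, and `E Λ(t)² = 2 ∫₀ᵗ E Λ λ ds`.

Taking expectations needs moments that are locally bounded in time, and this is obtained by
localizing up to the `n`-th event. There `E ∫ λ 1{s ≤ Tₙ} ds ≤ n + 1`, because it is the expected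
number of events up to `Tₙ`; likewise `E ∫ λ² 1{s ≤ Tₙ} ds` is an expected sum of at most `n + 1`
left limits `λ(Tₖ-)`, which only involve first moments. So the localized moments are integrable in
time, Gronwall's inequality `le_of_le_add_mul_lintegral` bounds them uniformly in `n`, and `n → ∞`
concludes (`lintegral_le_of_localized`).
-/

namespace SelfExciting

/-! ### Integral inequalities and equations, and càdlàg paths -/

/-- Gronwall's inequality for functions with values in `[0, ∞]`. Integrability of `u` is the only
regularity assumed; the constant is not optimal. -/
theorem le_of_le_add_mul_lintegral {u : ℝ → ℝ≥0∞} {t : ℝ} {B : ℝ≥0∞} {K : ℝ≥0}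
    (hB : B ≠ ∞) (hfin : ∫⁻ s in Ioc 0 t, u s ≠ ∞)
    (h : ∀ s ∈ Icc 0 t, u s ≤ B + K * ∫⁻ r in Ioc 0 s, u r) :
    ∀ s ∈ Icc 0 t, u s ≤ 2 * B * ENNReal.ofReal (Real.exp ((2 * K + 1) * t)) := by
  set L : ℝ := 2 * K + 1 with hL
  have hLpos : 0 < L := by positivity
  -- the weight `exp (-L s)` turns the integral term into a contraction with factor `1/2`
  set S : ℝ≥0∞ := ⨆ s ∈ Icc 0 t, u s * ENNReal.ofReal (Real.exp (-(L * s))) with hS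
  have hmono : ∀ s ∈ Icc 0 t, ∫⁻ r in Ioc 0 s, u r ≤ ∫⁻ r in Ioc 0 t, u r := fun s hs =>
    lintegral_mono_set (Ioc_subset_Ioc_right hs.2)
  have hSfin : S ≠ ∞ := by
    refine ne_top_of_le_ne_top (b := B + K * ∫⁻ r in Ioc 0 t, u r) (by finiteness) ?_
    refine iSup₂_le fun s hs => ?_
    calc u s * ENNReal.ofReal (Real.exp (-(L * s))) ≤ u s * 1 := by
          gcongr
          rw [ENNReal.ofReal_le_one, Real.exp_le_one_iff]
          have := mul_nonneg hLpos.le hs.1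
          linarith
      _ ≤ B + K * ∫⁻ r in Ioc 0 s, u r := by simpa using h s hs
      _ ≤ _ := by gcongr; exact hs.2
  have hexp : ∀ s, ENNReal.ofReal (Real.exp (-(L * s))) * ENNReal.ofReal (Real.exp (L * s)) =
      1 := by
    intro s
    rw [← ENNReal.ofReal_mul (by positivity), ← Real.exp_add]
    simp
  have hu : ∀ s ∈ Icc 0 t, u s ≤ S * ENNReal.ofReal (Real.exp (L * s)) := by
    intro s hs
    calc u s = u s * ENNReal.ofReal (Real.exp (-(L * s))) * ENNReal.ofReal (Real.exp (L * s)) := by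
          rw [mul_assoc, hexp, mul_one]
      _ ≤ _ := by
          gcongr
          exact le_iSup₂ (f := fun s (_ : s ∈ Icc 0 t) =>
            u s * ENNReal.ofReal (Real.exp (-(L * s)))) s hs
  have hint : ∀ s, 0 ≤ s → ∫⁻ r in Ioc 0 s, ENNReal.ofReal (Real.exp (L * r)) ≤
      ENNReal.ofReal (Real.exp (L * s) / L) := by
    intro s hs
    rw [← ofReal_integral_eq_lintegral_ofReal, ← intervalIntegral.integral_of_le hs]
    · apply ENNReal.ofReal_le_ofReal
      rw [intervalIntegral.integral_comp_mul_left (fun x => Real.exp x) hLpos.ne']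
      simp only [mul_zero, integral_exp, Real.exp_zero, smul_eq_mul]
      rw [div_eq_inv_mul]
      gcongr
      linarith
    · exact (Continuous.integrableOn_Ioc (by fun_prop))
    · exact Eventually.of_forall fun x => (Real.exp_pos _).le
  have hK : (K : ℝ≥0∞) * ENNReal.ofReal (1 / L) ≤ 2⁻¹ := by
    rw [← ENNReal.ofReal_coe_nnreal, ← ENNReal.ofReal_mul (by positivity)]
    calc ENNReal.ofReal (K * (1 / L)) ≤ ENNReal.ofReal (1 / 2) := by
          apply ENNReal.ofReal_le_ofReal
          rw [mul_one_div, div_le_div_iff₀ hLpos (by norm_num)]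
          rw [hL]; linarith
      _ = 2⁻¹ := by
          rw [one_div, ENNReal.ofReal_inv_of_pos (by norm_num)]; simp
  have hS2 : S ≤ B + 2⁻¹ * S := by
    refine iSup₂_le fun s hs => ?_
    have h1 : ∫⁻ r in Ioc 0 s, u r ≤ S * ENNReal.ofReal (Real.exp (L * s) / L) := by
      calc ∫⁻ r in Ioc 0 s, u r ≤ ∫⁻ r in Ioc 0 s, S * ENNReal.ofReal (Real.exp (L * r)) :=
            setLIntegral_mono' measurableSet_Ioc fun r hr => hu r ⟨hr.1.le, hr.2.trans hs.2⟩
        _ = S * ∫⁻ r in Ioc 0 s, ENNReal.ofReal (Real.exp (L * r)) :=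
            lintegral_const_mul _ (by fun_prop)
        _ ≤ _ := by gcongr; exact hint s hs.1
    calc u s * ENNReal.ofReal (Real.exp (-(L * s)))
        ≤ (B + K * (S * ENNReal.ofReal (Real.exp (L * s) / L))) *
            ENNReal.ofReal (Real.exp (-(L * s))) := by
          gcongr
          exact (h s hs).trans (by gcongr)
      _ = B * ENNReal.ofReal (Real.exp (-(L * s))) + (K * ENNReal.ofReal (1 / L)) * S *
            (ENNReal.ofReal (Real.exp (-(L * s))) * ENNReal.ofReal (Real.exp (L * s))) := by
          rw [show Real.exp (L * s) / L = (1 / L) * Real.exp (L * s) by ring,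
            ENNReal.ofReal_mul (by positivity)]
          ring
      _ ≤ B * 1 + 2⁻¹ * S * 1 := by
          rw [hexp]
          gcongr
          rw [ENNReal.ofReal_le_one, Real.exp_le_one_iff]
          have := mul_nonneg hLpos.le hs.1
          linarith
      _ = _ := by simp
  have hS3 : S ≤ 2 * B := by
    have h2 : 2⁻¹ * S + 2⁻¹ * S ≤ B + 2⁻¹ * S := by
      rw [← add_mul, ENNReal.inv_two_add_inv_two, one_mul]; exact hS2
    have h3 : 2⁻¹ * S ≤ B :=
      (ENNReal.add_le_add_iff_right (by finiteness)).1 h2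
    calc S = 2 * (2⁻¹ * S) := by
          rw [← mul_assoc, ENNReal.mul_inv_cancel (by norm_num) (by norm_num), one_mul]
      _ ≤ 2 * B := by gcongr
  intro s hs
  refine (hu s hs).trans ?_
  gcongr
  exact hs.2

/-- Uniqueness for the linear integral equation `u(t) = c + ∫₀ᵗ (g + κ u) ds`, by Gronwall's
inequality for the difference of two solutions. -/
theorem eq_of_eq_add_integral {u φ g : ℝ → ℝ} {c κ : ℝ}
    (hu : ∀ t, 0 ≤ t → IntervalIntegrable u volume 0 t)
    (hg : Continuous g)
    (h : ∀ t, 0 ≤ t → u t = c + ∫ s in (0 : ℝ)..t, (g s + κ * u s))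
    (hφ : ∀ t, HasDerivAt φ (g t + κ * φ t) t) (hφ0 : φ 0 = c) :
    ∀ t, 0 ≤ t → u t = φ t := by
  intro t ht
  have hφc : Continuous φ := continuous_iff_continuousAt.2 fun t => (hφ t).continuousAt
  have hφi : ∀ t, 0 ≤ t → φ t = c + ∫ s in (0 : ℝ)..t, (g s + κ * φ s) := by
    intro t _
    rw [intervalIntegral.integral_eq_sub_of_hasDerivAt (fun s _ => hφ s)
      ((Continuous.intervalIntegrable (by fun_prop)) _ _), hφ0]
    ring
  have hD : ∀ s ∈ Icc 0 t, u s - φ s = ∫ r in (0 : ℝ)..s, κ * (u r - φ r) := by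
    intro s hs
    rw [h s hs.1, hφi s hs.1, add_sub_add_left_eq_sub, ← intervalIntegral.integral_sub]
    · congr 1; ext r; ring
    · exact (hg.intervalIntegrable _ _).add ((hu s hs.1).const_mul _)
    · exact Continuous.intervalIntegrable (by fun_prop) _ _
  have hDint : IntegrableOn (fun s => u s - φ s) (Ioc 0 t) :=
    ((hu t ht).sub (hφc.intervalIntegrable _ _)).1
  have key := le_of_le_add_mul_lintegral (u := fun s => ‖u s - φ s‖ₑ) (t := t) (B := 0)
    (K := ‖κ‖₊) (by simp) hDint.2.ne (by
      intro s hs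
      rw [zero_add]
      rw [hD s hs, intervalIntegral.integral_of_le hs.1]
      refine (enorm_integral_le_lintegral_enorm _).trans ?_
      simp only [enorm_mul]
      rw [lintegral_const_mul' _ _ (by simp)]
      rfl) t ⟨ht, le_rfl⟩
  simpa [sub_eq_zero] using key

/-- A real path indexed by `ℝ` that is right-continuous and has left limits. -/
structure IsCadlag (f : ℝ → ℝ) : Prop where
  right : ∀ s, ContinuousWithinAt f (Ici s) s
  left : ∀ s, ∃ l, Tendsto f (𝓝[<] s) (𝓝 l)

namespace IsCadlag

variable {f g : ℝ → ℝ}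

theorem of_continuous (hf : Continuous f) : IsCadlag f :=
  ⟨fun _ => hf.continuousWithinAt, fun s => ⟨f s, hf.continuousWithinAt⟩⟩

theorem mul (hf : IsCadlag f) (hg : IsCadlag g) : IsCadlag (fun s => f s * g s) :=
  ⟨fun s => (hf.right s).mul (hg.right s), fun s => by
    obtain ⟨a, ha⟩ := hf.left s
    obtain ⟨b, hb⟩ := hg.left s
    exact ⟨a * b, ha.mul hb⟩⟩

theorem sub (hf : IsCadlag f) (hg : IsCadlag g) : IsCadlag (fun s => f s - g s) :=
  ⟨fun s => (hf.right s).sub (hg.right s), fun s => by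
    obtain ⟨a, ha⟩ := hf.left s
    obtain ⟨b, hb⟩ := hg.left s
    exact ⟨a - b, ha.sub hb⟩⟩

end IsCadlag

/-- The point of the grid `ℤ / (n + 1)` that follows `s` strictly. -/
noncomputable def gridAbove (n : ℕ) (s : ℝ) : ℝ := (⌊s * (n + 1)⌋ + 1) / (n + 1)

theorem lt_gridAbove (n : ℕ) (s : ℝ) : s < gridAbove n s := by
  rw [gridAbove, lt_div_iff₀ (by positivity)]
  exact Int.lt_floor_add_one _

theorem gridAbove_le (n : ℕ) (s : ℝ) : gridAbove n s ≤ s + 1 / (n + 1) := by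
  rw [gridAbove, div_le_iff₀ (by positivity), add_mul, one_div, inv_mul_cancel₀ (by positivity)]
  have := Int.floor_le (s * ((n : ℝ) + 1))
  linarith

theorem tendsto_gridAbove (s : ℝ) :
    Tendsto (fun n => gridAbove n s) atTop (𝓝[>] s) := by
  refine tendsto_nhdsWithin_iff.2 ⟨?_, Eventually.of_forall fun n => lt_gridAbove n s⟩
  refine tendsto_of_tendsto_of_tendsto_of_le_of_le tendsto_const_nhds ?_
    (fun n => (lt_gridAbove n s).le) (fun n => gridAbove_le n s)
  simpa using tendsto_const_nhds.add (tendsto_one_div_add_atTop_nhds_zero_nat (𝕜 := ℝ))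

namespace IsCadlag

variable {f g : ℝ → ℝ}

theorem measurable (hf : IsCadlag f) : Measurable f := by
  refine measurable_of_tendsto_metrizable (f := fun n s => f (gridAbove n s)) (fun n => ?_) ?_
  · exact (measurable_from_top (f := fun k : ℤ => f (((k : ℝ) + 1) / (n + 1)))).comp
      (Int.measurable_floor.comp (by fun_prop : Measurable fun s : ℝ => s * ((n : ℝ) + 1)))
  · refine tendsto_pi_nhds.2 fun s => ?_
    exact ((hf.right s).mono Ioi_subset_Ici_self).tendsto.comp (tendsto_gridAbove s)

theorem locallyIntegrable (hf : IsCadlag f) : LocallyIntegrable f := by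
  intro s
  rw [← nhdsLT_sup_nhdsGE, IntegrableAtFilter.sup_iff]
  obtain ⟨l, hl⟩ := hf.left s
  refine ⟨hl.integrableAtFilter ?_ ?_, (hf.right s).tendsto.integrableAtFilter ?_ ?_⟩
  · exact hf.measurable.aestronglyMeasurable.stronglyMeasurableAtFilter
  · exact Measure.finiteAt_nhdsWithin _ _ _
  · exact hf.measurable.aestronglyMeasurable.stronglyMeasurableAtFilter
  · exact Measure.finiteAt_nhdsWithin _ _ _

theorem intervalIntegrable (hf : IsCadlag f) (a b : ℝ) : IntervalIntegrable f volume a b :=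
  (hf.locallyIntegrable.integrableOn_isCompact isCompact_uIcc).intervalIntegrable

theorem continuous_primitive (hf : IsCadlag f) (c : ℝ) :
    Continuous fun s => c + ∫ r in (0 : ℝ)..s, f r :=
  continuous_const.add (intervalIntegral.continuous_primitive hf.intervalIntegrable 0)

theorem hasDerivWithinAt_primitive (hf : IsCadlag f) (c s : ℝ) :
    HasDerivWithinAt (fun s => c + ∫ r in (0 : ℝ)..s, f r) (f s) (Ioi s) s := by
  have := (intervalIntegral.integral_hasDerivWithinAt_right (hf.intervalIntegrable 0 s)
    (s := Ici s) (t := Ioi s)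
    (hf.measurable.stronglyMeasurable.stronglyMeasurableAtFilter)
    ((hf.right s).mono Ioi_subset_Ici_self)).const_add c
  exact this.mono Ioi_subset_Ici_self

/-- The product rule for two primitives of càdlàg functions, which are differentiable from the
right. -/
theorem primitive_mul_primitive (hf : IsCadlag f) (hg : IsCadlag g) (c d t : ℝ) :
    (c + ∫ r in (0 : ℝ)..t, f r) * (d + ∫ r in (0 : ℝ)..t, g r) =
      c * d + ∫ s in (0 : ℝ)..t,
        (f s * (d + ∫ r in (0 : ℝ)..s, g r) + (c + ∫ r in (0 : ℝ)..s, f r) * g s) := by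
  rw [intervalIntegral.integral_deriv_mul_eq_sub_of_hasDeriv_right
    (hf.continuous_primitive c).continuousOn (hg.continuous_primitive d).continuousOn
    (fun x _ => hf.hasDerivWithinAt_primitive c x) (fun x _ => hg.hasDerivWithinAt_primitive d x)
    (hf.intervalIntegrable _ _) (hg.intervalIntegrable _ _)]
  simp

end IsCadlag

/-! ### Product formulas along a path with finitely many jumps -/

theorem ite_mul_eq_indicator (τ x : ℝ) (h : ℝ → ℝ) :
    (fun s => (if τ ≤ s then x else 0) * h s) = (Ici τ).indicator fun s => x * h s := by
  ext s
  by_cases hs : τ ≤ s <;> simp [hs]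

theorem IsCadlag.intervalIntegrable_jumps_mul {h : ℝ → ℝ} (hh : IsCadlag h) (S : Finset ℕ)
    (τ x : ℕ → ℝ) (a b : ℝ) :
    IntervalIntegrable (fun s => (∑ k ∈ S, if τ k ≤ s then x k else 0) * h s) volume a b := by
  simp only [Finset.sum_mul]
  have hk : ∀ k ∈ S, IntervalIntegrable (fun s => (if τ k ≤ s then x k else 0) * h s)
      volume a b := by
    intro k _
    simp only [ite_mul_eq_indicator]
    have := (hh.intervalIntegrable a b).const_mul (x k)
    exact ⟨this.1.indicator measurableSet_Ici, this.2.indicator measurableSet_Ici⟩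
  rw [show (fun s => ∑ k ∈ S, (if τ k ≤ s then x k else 0) * h s) =
    ∑ k ∈ S, fun s => (if τ k ≤ s then x k else 0) * h s by ext s; simp]
  exact IntervalIntegrable.sum S hk

theorem IsCadlag.primitive_mul_jump {h : ℝ → ℝ} (hh : IsCadlag h) (c x : ℝ) {τ t : ℝ}
    (h0 : 0 ≤ τ) (ht : τ ≤ t) :
    (c + ∫ r in (0 : ℝ)..t, h r) * x = (c + ∫ r in (0 : ℝ)..τ, h r) * x +
      ∫ s in (0 : ℝ)..t, (if τ ≤ s then x else 0) * h s := by
  have h1 : ∫ s in (0 : ℝ)..t, (if τ ≤ s then x else 0) * h s = x * ∫ s in τ..t, h s := by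
    rw [ite_mul_eq_indicator, intervalIntegral.integral_of_le (h0.trans ht),
      intervalIntegral.integral_of_le ht, setIntegral_indicator measurableSet_Ici,
      ← integral_const_mul, ← integral_Icc_eq_integral_Ioc (x := τ)]
    apply setIntegral_congr_set
    have : Icc τ t =ᵐ[volume] (Ioc 0 t ∩ Ici τ : Set ℝ) := by
      rcases h0.eq_or_lt with rfl | h0
      · have : Ioc 0 t ∩ Ici 0 = Ioc 0 t := by
          ext y; simp only [mem_inter_iff, mem_Ioc, mem_Ici]
          exact ⟨fun h => h.1, fun h => ⟨h, h.1.le⟩⟩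
        rw [this]
        exact Ioc_ae_eq_Icc.symm
      · have : Ioc 0 t ∩ Ici τ = Icc τ t := by
          ext y; simp only [mem_inter_iff, mem_Ioc, mem_Ici, mem_Icc]
          exact ⟨fun h => ⟨h.2, h.1.2⟩, fun h => ⟨⟨h0.trans_le h.1, h.2⟩, h.1⟩⟩
        exact this.symm ▸ ae_eq_refl _
    exact this.symm
  rw [h1, ← intervalIntegral.integral_add_adjacent_intervals (hh.intervalIntegrable 0 τ)
    (hh.intervalIntegrable τ t)]
  ring

/-- Integration by parts of a primitive against a pure jump path with jumps `x k` at the times `τ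
k`. -/
theorem IsCadlag.primitive_mul_sum_jumps {h : ℝ → ℝ} (hh : IsCadlag h) (c : ℝ) (S : Finset ℕ)
    (τ x : ℕ → ℝ) {t : ℝ} (hτ : ∀ k ∈ S, 0 ≤ τ k ∧ τ k ≤ t) :
    (c + ∫ r in (0 : ℝ)..t, h r) * ∑ k ∈ S, x k =
      ∑ k ∈ S, (c + ∫ r in (0 : ℝ)..τ k, h r) * x k +
      ∫ s in (0 : ℝ)..t, (∑ k ∈ S, if τ k ≤ s then x k else 0) * h s := by
  have : ∫ s in (0 : ℝ)..t, (∑ k ∈ S, if τ k ≤ s then x k else 0) * h s =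
      ∑ k ∈ S, ∫ s in (0 : ℝ)..t, (if τ k ≤ s then x k else 0) * h s := by
    simp only [Finset.sum_mul]
    refine intervalIntegral.integral_finsetSum fun k _ => ?_
    simpa using hh.intervalIntegrable_jumps_mul {k} τ x 0 t
  rw [this, Finset.mul_sum, ← Finset.sum_add_distrib]
  exact Finset.sum_congr rfl fun k hk => hh.primitive_mul_jump c (x k) (hτ k hk).1 (hτ k hk).2

theorem sum_range_sq_eq (x : ℕ → ℝ) (n : ℕ) :
    (∑ k ∈ Finset.range n, x k) ^ 2 =
      ∑ k ∈ Finset.range n, (2 * (∑ j ∈ Finset.range k, x j) * x k + x k ^ 2) := by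
  induction n with
  | zero => simp
  | succ n ih => rw [Finset.sum_range_succ, Finset.sum_range_succ, ← ih]; ring

section Path

variable {l : ℝ → ℝ} {a α l₀ β t : ℝ} {n : ℕ} {τ x : ℕ → ℝ}

/-- The product of a primitive with a solution `l` of `dl = α (l₀ - l) dt + β dU`, where `U` jumps
by `x k` at the time `τ k`. -/
theorem primitive_mul_path (hl : IsCadlag l) (ht : 0 ≤ t)
    (hτ : ∀ k ∈ Finset.range n, 0 ≤ τ k ∧ τ k ≤ t)
    (hpath : ∀ s ∈ Icc 0 t, l s = a + (∫ r in (0 : ℝ)..s, α * (l₀ - l r)) +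
      β * ∑ k ∈ Finset.range n, if τ k ≤ s then x k else 0)
    {h : ℝ → ℝ} (hh : IsCadlag h) (c : ℝ) :
    (c + ∫ r in (0 : ℝ)..t, h r) * l t =
      c * a + (∫ s in (0 : ℝ)..t,
        (h s * l s + (c + ∫ r in (0 : ℝ)..s, h r) * (α * (l₀ - l s)))) +
      β * ∑ k ∈ Finset.range n, (c + ∫ r in (0 : ℝ)..τ k, h r) * x k := by
  have hj : IsCadlag fun s => α * (l₀ - l s) :=
    (IsCadlag.of_continuous continuous_const).mul
      ((IsCadlag.of_continuous continuous_const).sub hl)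
  have hsum : (∑ k ∈ Finset.range n, if τ k ≤ t then x k else 0) = ∑ k ∈ Finset.range n, x k :=
    Finset.sum_congr rfl fun k hk => by simp [(hτ k hk).2]
  have e1 := hh.primitive_mul_primitive hj c a t
  have e2 := hh.primitive_mul_sum_jumps c _ τ x hτ
  have e3 : ∫ s in (0 : ℝ)..t, (h s * l s + (c + ∫ r in (0 : ℝ)..s, h r) * (α * (l₀ - l s))) =
      (∫ s in (0 : ℝ)..t, (h s * (a + ∫ r in (0 : ℝ)..s, α * (l₀ - l r)) +
        (c + ∫ r in (0 : ℝ)..s, h r) * (α * (l₀ - l s)))) +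
      β * ∫ s in (0 : ℝ)..t, (∑ k ∈ Finset.range n, if τ k ≤ s then x k else 0) * h s := by
    rw [← intervalIntegral.integral_const_mul, ← intervalIntegral.integral_add]
    · refine intervalIntegral.integral_congr fun s hs => ?_
      rw [uIcc_of_le ht] at hs
      have := hpath s hs
      linear_combination h s * this
    · exact ((hh.intervalIntegrable _ _).mul_continuousOn
        (hj.continuous_primitive a).continuousOn).add
        ((hj.intervalIntegrable _ _).continuousOn_mul (hh.continuous_primitive c).continuousOn)
    · exact (hh.intervalIntegrable_jumps_mul _ τ x _ _).const_mul _
  rw [e3, hpath t ⟨ht, le_rfl⟩, hsum, mul_add, e1]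
  linear_combination β * e2

/-- The square of a solution `l` of `dl = α (l₀ - l) dt + β dU`. The factor of `x k` in the sum is
the left limit of `l` at `τ k` when the `τ k` increase strictly. -/
theorem path_sq (hl : IsCadlag l) (ht : 0 ≤ t)
    (hτ : ∀ k ∈ Finset.range n, 0 ≤ τ k ∧ τ k ≤ t)
    (hpath : ∀ s ∈ Icc 0 t, l s = a + (∫ r in (0 : ℝ)..s, α * (l₀ - l r)) +
      β * ∑ k ∈ Finset.range n, if τ k ≤ s then x k else 0) :
    l t ^ 2 = a ^ 2 + 2 * (∫ s in (0 : ℝ)..t, l s * (α * (l₀ - l s))) +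
      ∑ k ∈ Finset.range n, (2 * β * ((a + (∫ r in (0 : ℝ)..τ k, α * (l₀ - l r)) +
        β * ∑ j ∈ Finset.range k, x j) * x k) + β ^ 2 * x k ^ 2) := by
  have hj : IsCadlag fun s => α * (l₀ - l s) :=
    (IsCadlag.of_continuous continuous_const).mul
      ((IsCadlag.of_continuous continuous_const).sub hl)
  have hsum : (∑ k ∈ Finset.range n, if τ k ≤ t then x k else 0) = ∑ k ∈ Finset.range n, x k :=
    Finset.sum_congr rfl fun k hk => by simp [(hτ k hk).2]
  have e1 := hj.primitive_mul_primitive hj a a t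
  have e2 := hj.primitive_mul_sum_jumps a _ τ x hτ
  have e4 := sum_range_sq_eq x n
  have e3 : 2 * (∫ s in (0 : ℝ)..t, l s * (α * (l₀ - l s))) =
      (∫ s in (0 : ℝ)..t, (α * (l₀ - l s) * (a + ∫ r in (0 : ℝ)..s, α * (l₀ - l r)) +
        (a + ∫ r in (0 : ℝ)..s, α * (l₀ - l r)) * (α * (l₀ - l s)))) +
      2 * β * ∫ s in (0 : ℝ)..t,
        (∑ k ∈ Finset.range n, if τ k ≤ s then x k else 0) * (α * (l₀ - l s)) := by
    rw [← intervalIntegral.integral_const_mul, ← intervalIntegral.integral_const_mul,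
      ← intervalIntegral.integral_add]
    · refine intervalIntegral.integral_congr fun s hs => ?_
      rw [uIcc_of_le ht] at hs
      have := hpath s hs
      linear_combination 2 * (α * (l₀ - l s)) * this
    · exact ((hj.intervalIntegrable _ _).mul_continuousOn
        (hj.continuous_primitive a).continuousOn).add
        ((hj.intervalIntegrable _ _).continuousOn_mul (hj.continuous_primitive a).continuousOn)
    · exact (hj.intervalIntegrable_jumps_mul _ τ x _ _).const_mul _
  have e5 : ∑ k ∈ Finset.range n, (2 * β * ((a + (∫ r in (0 : ℝ)..τ k, α * (l₀ - l r)) +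
        β * ∑ j ∈ Finset.range k, x j) * x k) + β ^ 2 * x k ^ 2) =
      2 * β * ∑ k ∈ Finset.range n, (a + ∫ r in (0 : ℝ)..τ k, α * (l₀ - l r)) * x k +
      β ^ 2 * ∑ k ∈ Finset.range n, (2 * (∑ j ∈ Finset.range k, x j) * x k + x k ^ 2) := by
    rw [Finset.mul_sum, Finset.mul_sum, ← Finset.sum_add_distrib]
    exact Finset.sum_congr rfl fun k _ => by ring
  rw [e3, e5, hpath t ⟨ht, le_rfl⟩, hsum]
  linear_combination e1 + 2 * β * e2 + β ^ 2 * e4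

end Path

/-! ### The predictable σ-algebra and the strict past of an event -/

theorem tendsto_toNNReal_nhdsGE (s : ℝ) :
    Tendsto Real.toNNReal (𝓝[≥] s) (𝓝[≥] s.toNNReal) :=
  tendsto_nhdsWithin_iff.2 ⟨(continuous_real_toNNReal.tendsto s).mono_left nhdsWithin_le_nhds,
    eventually_mem_nhdsWithin.mono fun _ hx => Real.toNNReal_le_toNNReal hx⟩

theorem tendsto_comp_gridAbove {y : ℝ≥0 → ℝ} (hy : ∀ t, ContinuousWithinAt y (Ici t) t) (u : ℝ) :
    Tendsto (fun n => y (gridAbove n u).toNNReal) atTop (𝓝 (y u.toNNReal)) :=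
  (hy _).tendsto.comp ((tendsto_toNNReal_nhdsGE u).comp
    ((tendsto_gridAbove u).mono_right (nhdsWithin_mono _ Ioi_subset_Ici_self)))

theorem gridAbove_eq_comp (n : ℕ) :
    ∃ (g : ℤ → ℝ) (c : ℝ → ℤ), Measurable c ∧ ∀ u, gridAbove n u = g (c u) :=
  ⟨fun k => (k + 1) / (n + 1), fun u => ⌊u * (n + 1)⌋,
    Int.measurable_floor.comp (measurable_id.mul_const _), fun _ => rfl⟩

theorem measurable_uncurry_of_rightContinuous {α : Type*} [MeasurableSpace α] {Y : ℝ≥0 → α → ℝ}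
    (hY : ∀ r, Measurable (Y r)) (hc : ∀ p t, ContinuousWithinAt (fun s => Y s p) (Ici t) t) :
    Measurable fun q : ℝ × α => Y q.1.toNNReal q.2 := by
  refine measurable_of_tendsto_metrizable
    (f := fun n q => Y (gridAbove n q.1).toNNReal q.2) (fun n => ?_)
    (tendsto_pi_nhds.2 fun q => ?_)
  swap
  · exact tendsto_comp_gridAbove (y := fun r => Y r q.2) (hc q.2) q.1
  obtain ⟨g, c, hcm, hg⟩ := gridAbove_eq_comp n
  have h1 : Measurable fun q : ℤ × α => Y (g q.1).toNNReal q.2 :=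
    measurable_from_prod_countable_right fun k => hY (g k).toNNReal
  simp only [hg]
  exact h1.comp ((hcm.comp measurable_fst).prodMk measurable_snd)

/-- Measurability of `∫₀ˢ Y_u du` with respect to a σ-algebra for which only the truncations
`1{r < s} Y_r` are measurable. With the strict inequality this applies to the predictable σ-algebra;
approximating `u` from strictly above makes `1{u < s}` converge. -/
theorem measurable_integral_of_measurable_lt {α : Type*} [MeasurableSpace α] {s : α → ℝ≥0}
    {Y : ℝ≥0 → α → ℝ} (hY : ∀ r, Measurable fun p => if r < s p then Y r p else 0)
    (hc : ∀ p t, ContinuousWithinAt (fun s => Y s p) (Ici t) t) :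
    Measurable fun p => ∫ u in (0 : ℝ)..(s p), Y u.toNNReal p := by
  have hF : Measurable fun q : α × ℝ =>
      if 0 < q.2 then (if q.2.toNNReal < s q.1 then Y q.2.toNNReal q.1 else 0) else 0 := by
    refine measurable_of_tendsto_metrizable (f := fun n q =>
      if 0 < q.2 then (if (gridAbove n q.2).toNNReal < s q.1 then
        Y (gridAbove n q.2).toNNReal q.1 else 0) else 0) (fun n => ?_)
      (tendsto_pi_nhds.2 fun q => ?_)
    · obtain ⟨g, c, hcm, hg⟩ := gridAbove_eq_comp n
      have h1 : Measurable fun q : ℤ × α =>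
          if (g q.1).toNNReal < s q.2 then Y (g q.1).toNNReal q.2 else 0 :=
        measurable_from_prod_countable_right fun k => hY (g k).toNNReal
      simp only [hg]
      exact Measurable.ite (measurableSet_lt measurable_const measurable_snd)
        (h1.comp ((hcm.comp measurable_snd).prodMk measurable_fst)) measurable_const
    · by_cases h0 : 0 < q.2
      · simp only [h0, if_true]
        by_cases hs : q.2.toNNReal < s q.1
        · simp only [hs, if_true]
          have hev : ∀ᶠ n in atTop, (gridAbove n q.2).toNNReal < s q.1 :=
            (((continuous_real_toNNReal.tendsto q.2).comp
              ((tendsto_gridAbove q.2).mono_right nhdsWithin_le_nhds))).eventually_lt_const hs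
          refine (tendsto_comp_gridAbove (hc q.1) q.2).congr' ?_
          filter_upwards [hev] with n hn
          simp [hn]
        · have : ∀ n, ¬ (gridAbove n q.2).toNNReal < s q.1 := fun n hn =>
            hs ((Real.toNNReal_le_toNNReal (lt_gridAbove n q.2).le).trans_lt hn)
          simp [hs, this]
      · simp [h0]
  have := (hF.stronglyMeasurable.integral_prod_right' (ν := (volume : Measure ℝ))).measurable
  convert this using 2 with p
  simp only
  rw [intervalIntegral.integral_of_le (s p).coe_nonneg, integral_Ioc_eq_integral_Ioo,
    ← integral_indicator measurableSet_Ioo]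
  congr 1
  ext u
  by_cases h0 : 0 < u
  · by_cases h1 : u < s p
    · have : u.toNNReal < s p := (Real.toNNReal_lt_iff_lt_coe h0.le).2 h1
      simp [h0, h1, this]
    · have : ¬ u.toNNReal < s p := fun h => h1 ((Real.toNNReal_lt_iff_lt_coe h0.le).1 h)
      simp [h0, h1, this]
  · simp [h0]

variable {Ω : Type*} {mΩ : MeasurableSpace Ω} {𝓕 : Filtration ℝ≥0 mΩ}

theorem predictable_le_prod : 𝓕.predictable ≤ (inferInstance : MeasurableSpace (ℝ≥0 × Ω)) :=
  measurableSpace_le_predictable_of_measurableSet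
    (fun _ hA => (measurableSet_singleton _).prod (𝓕.le _ _ hA))
    (fun _ _ hA => measurableSet_Ioi.prod (𝓕.le _ _ hA))

theorem measurable_fst_predictable : Measurable[𝓕.predictable] (Prod.fst : ℝ≥0 × Ω → ℝ≥0) := by
  refine @measurable_of_Ioi _ _ _ _ _ 𝓕.predictable _ _ _ _ fun a => ?_
  have := measurableSet_predictable_Ioi_prod (𝓕 := 𝓕) (i := a) (s := univ) MeasurableSet.univ
  convert this using 1
  ext p; simp

theorem measurable_ite_lt_predictable {r : ℝ≥0} {Y : Ω → ℝ} (hY : Measurable[𝓕 r] Y) :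
    Measurable[𝓕.predictable] fun p : ℝ≥0 × Ω => if r < p.1 then Y p.2 else 0 := by
  intro C hC
  have h1 := measurableSet_predictable_Ioi_prod (𝓕 := 𝓕) (i := r) (hY hC)
  have h2 := measurableSet_predictable_Ioi_prod (𝓕 := 𝓕) (i := r) (s := univ) MeasurableSet.univ
  have : (fun p : ℝ≥0 × Ω => if r < p.1 then Y p.2 else 0) ⁻¹' C =
      Ioi r ×ˢ (Y ⁻¹' C) ∪ ((Ioi r ×ˢ univ)ᶜ ∩ {_p | (0 : ℝ) ∈ C}) := by
    ext p
    by_cases h : r < p.1 <;> simp [h]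
  rw [this]
  exact h1.union (h2.compl.inter (MeasurableSet.const _))

/-- The stochastic interval `(τ, ∞)`, restricted to an event `A` that is known at time `τ`, is
predictable. -/
theorem measurableSet_predictable_lt {τ : Ω → WithTop ℝ≥0} {A : Set Ω}
    (hA : ∀ t : ℝ≥0, MeasurableSet[𝓕 t] (A ∩ {ω | τ ω ≤ t})) :
    MeasurableSet[𝓕.predictable] {p : ℝ≥0 × Ω | p.2 ∈ A ∧ τ p.2 < p.1} := by
  have : {p : ℝ≥0 × Ω | p.2 ∈ A ∧ τ p.2 < p.1} =
      ⋃ q : ℚ, Ioi (Real.toNNReal q) ×ˢ (A ∩ {ω | τ ω ≤ (Real.toNNReal q : ℝ≥0)}) := by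
    ext p
    simp only [mem_ofPred_eq, mem_iUnion, mem_prod, mem_Ioi, mem_inter_iff]
    constructor
    · rintro ⟨hpA, hlt⟩
      obtain ⟨r, hr⟩ := WithTop.ne_top_iff_exists.1 (hlt.trans_le le_top).ne
      rw [← hr, WithTop.coe_lt_coe] at hlt
      obtain ⟨q, -, h1, h2⟩ := (NNReal.lt_iff_exists_rat_btwn _ _).1 hlt
      exact ⟨q, h2, hpA, by rw [← hr]; exact_mod_cast h1.le⟩
    · rintro ⟨q, h1, h2, h3⟩
      exact ⟨h2, h3.trans_lt (by exact_mod_cast h1)⟩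
  rw [this]
  exact MeasurableSet.iUnion fun q => measurableSet_predictable_Ioi_prod (hA _)

theorem measurable_jump_predictable {τ : Ω → WithTop ℝ≥0} (hτ : IsStoppingTime 𝓕 τ) {Y : Ω → ℝ}
    (hY : ∀ (t : ℝ≥0) (C : Set ℝ), MeasurableSet C →
      MeasurableSet[𝓕 t] (Y ⁻¹' C ∩ {ω | τ ω ≤ (t : WithTop ℝ≥0)})) :
    Measurable[𝓕.predictable] fun p : ℝ≥0 × Ω => if τ p.2 < p.1 then Y p.2 else 0 := by
  intro C hC
  have h1 := measurableSet_predictable_lt (𝓕 := 𝓕) (τ := τ) (A := Y ⁻¹' C) (fun t => hY t C hC)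
  have h2 := measurableSet_predictable_lt (𝓕 := 𝓕) (τ := τ) (A := univ)
    (fun t => by simpa using hτ t)
  have : (fun p : ℝ≥0 × Ω => if τ p.2 < p.1 then Y p.2 else 0) ⁻¹' C =
      {p : ℝ≥0 × Ω | p.2 ∈ Y ⁻¹' C ∧ τ p.2 < p.1} ∪
        ({p : ℝ≥0 × Ω | p.2 ∈ univ ∧ τ p.2 < p.1}ᶜ ∩ {_p | (0 : ℝ) ∈ C}) := by
    ext p
    simp only [mem_preimage, mem_union, mem_inter_iff, mem_compl_iff, mem_ofPred_eq, mem_univ,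
      true_and]
    split_ifs with h
    · exact ⟨fun hp => Or.inl ⟨hp, h⟩, fun hp => hp.elim And.left fun hp => (hp.1 h).elim⟩
    · exact ⟨fun hp => Or.inr ⟨h, hp⟩, fun hp => hp.elim (fun hp => (h hp.2).elim) And.right⟩
  rw [this]
  exact h1.union (h2.compl.inter (MeasurableSet.const _))

theorem measurableSet_predictable_le {τ : Ω → WithTop ℝ≥0} (hτ : IsStoppingTime 𝓕 τ) :
    MeasurableSet[𝓕.predictable] {p : ℝ≥0 × Ω | (p.1 : WithTop ℝ≥0) ≤ τ p.2} := by
  have h2 := measurableSet_predictable_lt (𝓕 := 𝓕) (τ := τ) (A := univ)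
    (fun t => by simpa using hτ t)
  convert h2.compl using 1
  ext p
  simp only [mem_ofPred_eq, mem_compl_iff, mem_univ, true_and]
  exact not_lt.symm

theorem measurable_integral_predictable {lam : ℝ≥0 → Ω → ℝ} (ha : Adapted 𝓕 lam)
    (hc : ∀ ω t, ContinuousWithinAt (fun s => lam s ω) (Ici t) t) :
    Measurable[𝓕.predictable] fun p : ℝ≥0 × Ω => integratedIntensity lam p.1 p.2 :=
  @measurable_integral_of_measurable_lt _ 𝓕.predictable (fun p => p.1) (fun r p => lam r p.2)
    (fun r => measurable_ite_lt_predictable (ha r)) (fun p => hc p.2)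

theorem measurableSet_strictPast_lt {τ : Ω → WithTop ℝ≥0} {t : ℝ≥0} {A : Set Ω}
    (hA : MeasurableSet[𝓕 t] A) :
    MeasurableSet[strictPast 𝓕 τ] (A ∩ {ω | (t : WithTop ℝ≥0) < τ ω}) :=
  MeasurableSpace.measurableSet_generateFrom (Or.inr ⟨t, A, hA, rfl⟩)

theorem measurableSet_strictPast_lt_top {τ : Ω → WithTop ℝ≥0} :
    MeasurableSet[strictPast 𝓕 τ] {ω | τ ω < ⊤} := by
  have : {ω | τ ω < ⊤} = (⋂ n : ℕ, univ ∩ {ω | ((n : ℝ≥0) : WithTop ℝ≥0) < τ ω})ᶜ := by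
    ext ω
    simp only [mem_ofPred_eq, univ_inter, mem_compl_iff, mem_iInter, not_forall, not_lt]
    constructor
    · intro h
      obtain ⟨r, hr⟩ := WithTop.ne_top_iff_exists.1 h.ne
      obtain ⟨n, hn⟩ := exists_nat_ge r
      exact ⟨n, by rw [← hr]; exact_mod_cast hn⟩
    · rintro ⟨n, hn⟩
      exact hn.trans_lt (WithTop.coe_lt_top _)
  rw [this]
  exact (MeasurableSet.iInter fun n => measurableSet_strictPast_lt MeasurableSet.univ).compl

theorem strictPast_le {τ : Ω → WithTop ℝ≥0} (hτ : IsStoppingTime 𝓕 τ) : strictPast 𝓕 τ ≤ mΩ := by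
  refine MeasurableSpace.generateFrom_le ?_
  rintro B (hB | ⟨t, A, hA, rfl⟩)
  · exact 𝓕.le _ _ hB
  · refine (𝓕.le _ _ hA).inter ?_
    convert (𝓕.le _ _ (hτ t)).compl using 1
    ext ω
    simp only [mem_ofPred_eq, mem_compl_iff]
    exact not_le.symm

/-- A predictable process evaluated at a random time is known in the strict past of that time:
both σ-algebras are generated by what is decided strictly before. -/
theorem measurable_predictable_comp_strictPast {E : Type*} [MeasurableSpace E] [Zero E]
    {τ : Ω → WithTop ℝ≥0} {f : ℝ≥0 × Ω → E} (hf : Measurable[𝓕.predictable] f) :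
    Measurable[strictPast 𝓕 τ] fun ω => if τ ω < ⊤ then f ((τ ω).untopD 0, ω) else 0 := by
  have key : ∀ S, MeasurableSet[𝓕.predictable] S →
      MeasurableSet[strictPast 𝓕 τ] {ω | τ ω < ⊤ ∧ ((τ ω).untopD 0, ω) ∈ S} := by
    intro S hS
    induction S, hS using MeasurableSpace.generateFrom_induction with
    | hC S hS _ =>
      rcases hS with ⟨A, hA, rfl⟩ | ⟨t, A, hA, rfl⟩
      · have h0 : MeasurableSet[strictPast 𝓕 τ] A :=
          MeasurableSpace.measurableSet_generateFrom (Or.inl hA)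
        have h1 := measurableSet_strictPast_lt (𝓕 := 𝓕) (τ := τ) (t := 0) (A := univ)
          MeasurableSet.univ
        convert (h0.inter h1.compl).inter (measurableSet_strictPast_lt_top (𝓕 := 𝓕) (τ := τ))
          using 1
        ext ω
        simp only [mem_ofPred_eq, mem_prod, mem_inter_iff, mem_compl_iff, mem_univ, true_and,
          mem_singleton_iff]
        refine ⟨fun ⟨h1, h2, h3⟩ => ⟨⟨h3, ?_⟩, h1⟩, fun ⟨⟨h1, h2⟩, h3⟩ => ⟨h3, ?_, h1⟩⟩
        · obtain ⟨r, hr⟩ := WithTop.ne_top_iff_exists.1 h1.ne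
          rw [← hr, WithTop.untopD_coe] at h2
          rw [← hr, h2]
          exact lt_irrefl _
        · obtain ⟨r, hr⟩ := WithTop.ne_top_iff_exists.1 h3.ne
          rw [← hr] at h2 ⊢
          rw [WithTop.untopD_coe]
          rw [not_lt, WithTop.coe_le_coe] at h2
          exact le_antisymm h2 bot_le
      · convert (measurableSet_strictPast_lt (𝓕 := 𝓕) (τ := τ) hA).inter
          (measurableSet_strictPast_lt_top (𝓕 := 𝓕) (τ := τ)) using 1
        ext ω
        simp only [mem_ofPred_eq, mem_prod, mem_inter_iff, mem_Ioi]
        refine ⟨fun ⟨h1, h2, h3⟩ => ⟨⟨h3, ?_⟩, h1⟩, fun ⟨⟨h1, h2⟩, h3⟩ => ⟨h3, ?_, h1⟩⟩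
        · obtain ⟨r, hr⟩ := WithTop.ne_top_iff_exists.1 h1.ne
          rw [← hr, WithTop.untopD_coe] at h2
          rw [← hr]
          exact WithTop.coe_lt_coe.2 h2
        · obtain ⟨r, hr⟩ := WithTop.ne_top_iff_exists.1 h3.ne
          rw [← hr] at h2 ⊢
          exact WithTop.coe_lt_coe.1 h2
    | empty => simp
    | compl S _ ih =>
      convert (measurableSet_strictPast_lt_top (𝓕 := 𝓕) (τ := τ)).diff ih using 1
      ext ω; simp; tauto
    | iUnion S _ ih =>
      convert MeasurableSet.iUnion ih using 1
      ext ω; simp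
  intro C hC
  have : (fun ω => if τ ω < ⊤ then f ((τ ω).untopD 0, ω) else 0) ⁻¹' C =
      {ω | τ ω < ⊤ ∧ ((τ ω).untopD 0, ω) ∈ f ⁻¹' C} ∪ ({ω | τ ω < ⊤}ᶜ ∩ {_ω | (0 : E) ∈ C}) := by
    ext ω
    by_cases h : τ ω < ⊤ <;> simp [h]
  rw [this]
  exact (key _ (hf hC)).union
    ((measurableSet_strictPast_lt_top).compl.inter (MeasurableSet.const _))

/-! ### The compensation formula -/

variable {P : Measure Ω} {T : ℕ → Ω → WithTop ℝ≥0} {X : ℕ → Ω → ℝ} {lam : ℝ≥0 → Ω → ℝ}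
  {ν : Measure ℝ}

theorem measurable_comp_predictable {E : Type*} [MeasurableSpace E] {f : ℝ≥0 × Ω → E}
    (hf : Measurable[𝓕.predictable] f) : Measurable fun q : Ω × ℝ => f (q.2.toNNReal, q.1) :=
  (hf.mono predictable_le_prod le_rfl).comp
    ((measurable_real_toNNReal.comp measurable_snd).prodMk measurable_fst)

theorem IsIntensity.measurable_path (hI : IsIntensity P 𝓕 T lam) :
    Measurable fun q : Ω × ℝ => lam q.2.toNNReal q.1 :=
  (measurable_uncurry_of_rightContinuous (fun r => (hI.adapted r).mono (𝓕.le r) le_rfl)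
    hI.rightContinuous).comp measurable_swap

theorem IsPointProcess.measurableSet_lt_top (hT : IsPointProcess P 𝓕 T) (n : ℕ) :
    MeasurableSet {ω | T n ω < ⊤} :=
  strictPast_le (hT.isStoppingTime n) _ measurableSet_strictPast_lt_top

/-- The value at the `n`-th event time of a process, and `0` if there is no such event. -/
noncomputable def atEvent {E : Type*} [Zero E] (T : ℕ → Ω → WithTop ℝ≥0) (f : ℝ≥0 × Ω → E)
    (n : ℕ) (ω : Ω) : E :=
  if T n ω < ⊤ then f ((T n ω).untopD 0, ω) else 0

theorem measurable_atEvent (hT : IsPointProcess P 𝓕 T) {E : Type*} [MeasurableSpace E] [Zero E]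
    {f : ℝ≥0 × Ω → E} (hf : Measurable[𝓕.predictable] f) (n : ℕ) : Measurable (atEvent T f n) :=
  (measurable_predictable_comp_strictPast hf).mono (strictPast_le (hT.isStoppingTime n)) le_rfl

section Jump

variable [IsFiniteMeasure P] [IsProbabilityMeasure ν]

/-- On `{T_n < ∞}`, the jump size is independent of the strict past and has the law `ν`. -/
theorem map_prodMk_jump (hT : IsPointProcess P 𝓕 T) (hX : HasJumpLaw P 𝓕 T X ν) (n : ℕ)
    {E : Type*} [MeasurableSpace E] {Y : Ω → E} (hY : Measurable[strictPast 𝓕 (T n)] Y) :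
    (P.restrict {ω | T n ω < ⊤}).map (fun ω => (Y ω, X n ω)) =
      ((P.restrict {ω | T n ω < ⊤}).map Y).prod ν := by
  have hY' : Measurable Y := hY.mono (strictPast_le (hT.isStoppingTime n)) le_rfl
  symm
  refine Measure.prod_eq fun s t hs ht => ?_
  rw [Measure.map_apply (hY'.prodMk (hX.measurable n)) (hs.prod ht), Measure.map_apply hY' hs,
    Measure.restrict_apply' (hT.measurableSet_lt_top n),
    Measure.restrict_apply' (hT.measurableSet_lt_top n), ← hX.law n _ t (hY hs) ht]
  congr 1
  ext ω
  simp only [mem_inter_iff, mem_preimage, mem_prod]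
  tauto

theorem lintegral_mul_jump (hT : IsPointProcess P 𝓕 T) (hX : HasJumpLaw P 𝓕 T X ν) (n : ℕ)
    {Y : Ω → ℝ≥0∞} (hY : Measurable[strictPast 𝓕 (T n)] Y) {φ : ℝ → ℝ≥0∞} (hφ : Measurable φ) :
    ∫⁻ ω in {ω | T n ω < ⊤}, Y ω * φ (X n ω) ∂P =
      (∫⁻ ω in {ω | T n ω < ⊤}, Y ω ∂P) * ∫⁻ x, φ x ∂ν := by
  have hY' : Measurable Y := hY.mono (strictPast_le (hT.isStoppingTime n)) le_rfl
  have h := lintegral_map (μ := P.restrict {ω | T n ω < ⊤}) (f := fun q : ℝ≥0∞ × ℝ => q.1 * φ q.2)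
    (by fun_prop) (hY'.prodMk (hX.measurable n))
  rw [← h, map_prodMk_jump hT hX n hY, lintegral_prod_mul (f := fun y => y) (by fun_prop)
    (by fun_prop), lintegral_map (by fun_prop) hY']

theorem integral_mul_jump (hT : IsPointProcess P 𝓕 T) (hX : HasJumpLaw P 𝓕 T X ν) (n : ℕ)
    {Y : Ω → ℝ} (hY : Measurable[strictPast 𝓕 (T n)] Y) {φ : ℝ → ℝ} (hφ : Measurable φ) :
    ∫ ω in {ω | T n ω < ⊤}, Y ω * φ (X n ω) ∂P =
      (∫ ω in {ω | T n ω < ⊤}, Y ω ∂P) * ∫ x, φ x ∂ν := by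
  have hY' : Measurable Y := hY.mono (strictPast_le (hT.isStoppingTime n)) le_rfl
  have h := integral_map (μ := P.restrict {ω | T n ω < ⊤}) (f := fun q : ℝ × ℝ => q.1 * φ q.2)
    (hY'.prodMk (hX.measurable n)).aemeasurable
    (by fun_prop : Measurable fun q : ℝ × ℝ => q.1 * φ q.2).aestronglyMeasurable
  rw [← h, map_prodMk_jump hT hX n hY, integral_prod_mul (f := fun y => y),
    integral_map hY'.aemeasurable measurable_id'.aestronglyMeasurable]

theorem integral_atEvent_mul (hT : IsPointProcess P 𝓕 T) (hX : HasJumpLaw P 𝓕 T X ν)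
    {f : ℝ≥0 × Ω → ℝ} (hf : Measurable[𝓕.predictable] f) {φ : ℝ → ℝ} (hφ : Measurable φ) (n : ℕ) :
    ∫ ω, atEvent T f n ω * φ (X n ω) ∂P = (∫ ω, atEvent T f n ω ∂P) * ∫ x, φ x ∂ν := by
  have h := integral_mul_jump hT hX n
    (measurable_predictable_comp_strictPast (τ := T n) hf) hφ
  rwa [setIntegral_eq_integral_of_forall_compl_eq_zero (fun ω hω => by simp_all),
    setIntegral_eq_integral_of_forall_compl_eq_zero (fun ω hω => by simp_all)] at h

/-- The compensation formula for nonnegative processes. -/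
theorem lintegral_tsum_atEvent_mul (hT : IsPointProcess P 𝓕 T) (hX : HasJumpLaw P 𝓕 T X ν)
    (hI : IsIntensity P 𝓕 T lam) {f : ℝ≥0 × Ω → ℝ≥0∞} (hf : Measurable[𝓕.predictable] f)
    {φ : ℝ → ℝ≥0∞} (hφ : Measurable φ) :
    ∫⁻ ω, ∑' n, atEvent T f n ω * φ (X n ω) ∂P = (∫⁻ x, φ x ∂ν) *
      ∫⁻ ω, (∫⁻ s in Ioi (0 : ℝ), f (s.toNNReal, ω) * ENNReal.ofReal (lam s.toNNReal ω)) ∂P := by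
  have hm := measurable_atEvent hT hf
  have hn : ∀ n, ∫⁻ ω, atEvent T f n ω * φ (X n ω) ∂P =
      (∫⁻ ω, atEvent T f n ω ∂P) * ∫⁻ x, φ x ∂ν := by
    intro n
    have h := lintegral_mul_jump hT hX n
      (measurable_predictable_comp_strictPast (τ := T n) hf) hφ
    rwa [setLIntegral_eq_of_support_subset (fun ω hω => by
        by_contra hc
        exact hω (by simp_all)),
      setLIntegral_eq_of_support_subset (fun ω hω => by
        by_contra hc
        exact hω (by simp_all))] at h
  rw [lintegral_tsum (f := fun n ω => atEvent T f n ω * φ (X n ω))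
      fun n => ((hm n).mul (hφ.comp (hX.measurable n))).aemeasurable,
    tsum_congr hn, ENNReal.tsum_mul_right, ← lintegral_tsum fun n => (hm n).aemeasurable, mul_comm,
    ← hI.lintegral_eq f hf]
  rfl

omit [IsFiniteMeasure P] in
theorem hasSum_integral_atEvent_of_nonneg (hT : IsPointProcess P 𝓕 T)
    (hI : IsIntensity P 𝓕 T lam) {f : ℝ≥0 × Ω → ℝ} (hf : Measurable[𝓕.predictable] f)
    (hf0 : ∀ p, 0 ≤ f p)
    (hfin : ∫⁻ ω, (∫⁻ s in Ioi (0 : ℝ), ‖f (s.toNNReal, ω)‖ₑ * ENNReal.ofReal (lam s.toNNReal ω)) ∂P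
      ≠ ∞) :
    HasSum (fun n => ∫ ω, atEvent T f n ω ∂P)
      (∫ ω, (∫ s in Ioi (0 : ℝ), f (s.toNNReal, ω) * lam s.toNNReal ω) ∂P) := by
  have hm := measurable_atEvent hT hf
  have hfe : Measurable[𝓕.predictable] fun p => ‖f p‖ₑ := measurable_enorm.comp hf
  have hae : ∀ n ω, ENNReal.ofReal (atEvent T f n ω) = atEvent T (fun p => ‖f p‖ₑ) n ω := by
    intro n ω
    unfold atEvent
    split_ifs
    · exact (Real.enorm_of_nonneg (hf0 _)).symm
    · simp
  have h0 : ∀ n ω, 0 ≤ atEvent T f n ω := by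
    intro n ω
    unfold atEvent
    split_ifs
    exacts [hf0 _, le_rfl]
  have key : ∑' n, ∫⁻ ω, ENNReal.ofReal (atEvent T f n ω) ∂P =
      ∫⁻ ω, (∫⁻ s in Ioi (0 : ℝ), ‖f (s.toNNReal, ω)‖ₑ * ENNReal.ofReal (lam s.toNNReal ω)) ∂P := by
    rw [← hI.lintegral_eq _ hfe]
    simp only [hae]
    rw [← lintegral_tsum fun n => (measurable_atEvent hT hfe n).aemeasurable]
    rfl
  have hmeas : Measurable fun q : Ω × ℝ =>
      ‖f (q.2.toNNReal, q.1)‖ₑ * ENNReal.ofReal (lam q.2.toNNReal q.1) :=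
    (measurable_comp_predictable hfe).mul hI.measurable_path.ennreal_ofReal
  have hmeas' : Measurable fun ω =>
      ∫⁻ s in Ioi (0 : ℝ), ‖f (s.toNNReal, ω)‖ₑ * ENNReal.ofReal (lam s.toNNReal ω) :=
    hmeas.lintegral_prod_right'
  have hinner : (fun ω => ∫ s in Ioi (0 : ℝ), f (s.toNNReal, ω) * lam s.toNNReal ω) =ᵐ[P]
      fun ω => (∫⁻ s in Ioi (0 : ℝ), ‖f (s.toNNReal, ω)‖ₑ *
        ENNReal.ofReal (lam s.toNNReal ω)).toReal := by
    filter_upwards [hI.nonneg] with ω hω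
    rw [integral_eq_lintegral_of_nonneg_ae]
    · congr 2
      ext s
      rw [Real.enorm_of_nonneg (hf0 _), ENNReal.ofReal_mul (hf0 _)]
    · exact Eventually.of_forall fun s => mul_nonneg (hf0 _) (hω _)
    · exact (((measurable_comp_predictable hf).comp measurable_prodMk_left).mul
        (hI.measurable_path.comp measurable_prodMk_left)).aestronglyMeasurable
  rw [integral_congr_ae hinner, integral_toReal hmeas'.aemeasurable (ae_lt_top hmeas' hfin), ← key]
  have hn : ∀ n, ∫ ω, atEvent T f n ω ∂P =
      (∫⁻ ω, ENNReal.ofReal (atEvent T f n ω) ∂P).toReal := fun n =>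
    integral_eq_lintegral_of_nonneg_ae (Eventually.of_forall (h0 n)) (hm n).aestronglyMeasurable
  simp only [hn]
  rw [← key] at hfin
  rw [ENNReal.tsum_toReal_eq (ENNReal.ne_top_of_tsum_ne_top hfin)]
  exact (ENNReal.summable_toReal hfin).hasSum

omit [IsFiniteMeasure P] in
theorem integrable_mul_intensity (hI : IsIntensity P 𝓕 T lam) {f : ℝ≥0 × Ω → ℝ}
    (hf : Measurable[𝓕.predictable] f)
    (hfin : ∫⁻ ω, (∫⁻ s in Ioi (0 : ℝ), ‖f (s.toNNReal, ω)‖ₑ * ENNReal.ofReal (lam s.toNNReal ω)) ∂P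
      ≠ ∞) :
    Integrable (fun q : Ω × ℝ => f (q.2.toNNReal, q.1) * lam q.2.toNNReal q.1)
      (P.prod (volume.restrict (Ioi 0))) := by
  have hm : Measurable fun q : Ω × ℝ => f (q.2.toNNReal, q.1) * lam q.2.toNNReal q.1 :=
    (measurable_comp_predictable hf).mul hI.measurable_path
  refine ⟨hm.aestronglyMeasurable, ?_⟩
  rw [HasFiniteIntegral, lintegral_prod _ hm.enorm.aemeasurable]
  refine lt_of_eq_of_lt (lintegral_congr_ae ?_) hfin.lt_top
  filter_upwards [hI.nonneg] with ω hω
  refine lintegral_congr fun s => ?_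
  rw [enorm_mul, Real.enorm_of_nonneg (hω _)]

omit [IsFiniteMeasure P] in
theorem integrable_atEvent (hT : IsPointProcess P 𝓕 T)
    (hI : IsIntensity P 𝓕 T lam) {f : ℝ≥0 × Ω → ℝ} (hf : Measurable[𝓕.predictable] f)
    (hfin : ∫⁻ ω, (∫⁻ s in Ioi (0 : ℝ), ‖f (s.toNNReal, ω)‖ₑ * ENNReal.ofReal (lam s.toNNReal ω)) ∂P
      ≠ ∞) (n : ℕ) : Integrable (atEvent T f n) P := by
  have hfe : Measurable[𝓕.predictable] fun p => ‖f p‖ₑ := measurable_enorm.comp hf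
  refine ⟨(measurable_atEvent hT hf n).aestronglyMeasurable, lt_of_le_of_lt ?_ hfin.lt_top⟩
  rw [← hI.lintegral_eq _ hfe]
  refine lintegral_mono fun ω => le_trans (le_of_eq ?_)
    (ENNReal.le_tsum (f := fun n => atEvent T (fun p => ‖f p‖ₑ) n ω) n)
  simp only [atEvent]
  split_ifs <;> simp

/-- The intensity identity for signed predictable processes, by splitting into positive and negative
parts. -/
theorem hasSum_integral_atEvent (hT : IsPointProcess P 𝓕 T)
    (hI : IsIntensity P 𝓕 T lam) {f : ℝ≥0 × Ω → ℝ} (hf : Measurable[𝓕.predictable] f)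
    (hfin : ∫⁻ ω, (∫⁻ s in Ioi (0 : ℝ), ‖f (s.toNNReal, ω)‖ₑ * ENNReal.ofReal (lam s.toNNReal ω)) ∂P
      ≠ ∞) :
    HasSum (fun n => ∫ ω, atEvent T f n ω ∂P)
      (∫ ω, (∫ s in Ioi (0 : ℝ), f (s.toNNReal, ω) * lam s.toNNReal ω) ∂P) := by
  have hpos : Measurable[𝓕.predictable] fun p => max (f p) 0 := hf.max measurable_const
  have hneg : Measurable[𝓕.predictable] fun p => max (-f p) 0 := hf.neg.max measurable_const
  have fpos : ∫⁻ ω, (∫⁻ s in Ioi (0 : ℝ), ‖max (f (s.toNNReal, ω)) 0‖ₑ *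
      ENNReal.ofReal (lam s.toNNReal ω)) ∂P ≠ ∞ := by
    refine ne_top_of_le_ne_top hfin (lintegral_mono fun ω => lintegral_mono fun s => ?_)
    gcongr ?_ * _
    simp only [Real.enorm_eq_ofReal_abs]
    refine ENNReal.ofReal_le_ofReal ?_
    rw [abs_of_nonneg (le_max_right _ _)]
    exact max_le (le_abs_self _) (abs_nonneg _)
  have fneg : ∫⁻ ω, (∫⁻ s in Ioi (0 : ℝ), ‖max (-f (s.toNNReal, ω)) 0‖ₑ *
      ENNReal.ofReal (lam s.toNNReal ω)) ∂P ≠ ∞ := by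
    refine ne_top_of_le_ne_top hfin (lintegral_mono fun ω => lintegral_mono fun s => ?_)
    gcongr ?_ * _
    simp only [Real.enorm_eq_ofReal_abs]
    refine ENNReal.ofReal_le_ofReal ?_
    rw [abs_of_nonneg (le_max_right _ _)]
    exact max_le (neg_le_abs _) (abs_nonneg _)
  have hsub : ∀ y : ℝ, y = max y 0 - max (-y) 0 := fun y => by
    rcases le_total 0 y with h | h
    · rw [max_eq_left h, max_eq_right (by linarith)]; ring
    · rw [max_eq_right h, max_eq_left (by linarith)]; ring
  have hS := (hasSum_integral_atEvent_of_nonneg hT hI hpos (fun p => le_max_right _ _) fpos).sub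
    (hasSum_integral_atEvent_of_nonneg hT hI hneg (fun p => le_max_right _ _) fneg)
  have hfun : ∀ n, ∫ ω, atEvent T f n ω ∂P = ∫ ω, atEvent T (fun p => max (f p) 0) n ω ∂P -
      ∫ ω, atEvent T (fun p => max (-f p) 0) n ω ∂P := by
    intro n
    rw [← integral_sub (integrable_atEvent hT hI hpos fpos n)
      (integrable_atEvent hT hI hneg fneg n)]
    congr 1
    ext ω
    simp only [atEvent]
    split_ifs
    · exact hsub _
    · simp
  have hval : ∫ ω, (∫ s in Ioi (0 : ℝ), f (s.toNNReal, ω) * lam s.toNNReal ω) ∂P =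
      ∫ ω, (∫ s in Ioi (0 : ℝ), max (f (s.toNNReal, ω)) 0 * lam s.toNNReal ω) ∂P -
      ∫ ω, (∫ s in Ioi (0 : ℝ), max (-f (s.toNNReal, ω)) 0 * lam s.toNNReal ω) ∂P := by
    have e := integral_prod _ (integrable_mul_intensity hI hf hfin)
    have e1 := integral_prod _ (integrable_mul_intensity hI hpos fpos)
    have e2 := integral_prod _ (integrable_mul_intensity hI hneg fneg)
    simp only at e e1 e2
    rw [← e, ← e1, ← e2, ← integral_sub (integrable_mul_intensity hI hpos fpos)
        (integrable_mul_intensity hI hneg fneg)]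
    congr 1
    ext q
    linear_combination lam q.2.toNNReal q.1 * hsub (f (q.2.toNNReal, q.1))
  simp only [hfun, hval]
  exact hS

/-- **Compensation formula.** Summed over the events, a predictable process times a function of
the jump size has the same expectation as its integral against the intensity, times the mean of
that function under the jump law. -/
theorem integral_tsum_atEvent_mul (hT : IsPointProcess P 𝓕 T) (hX : HasJumpLaw P 𝓕 T X ν)
    (hI : IsIntensity P 𝓕 T lam) {f : ℝ≥0 × Ω → ℝ} (hf : Measurable[𝓕.predictable] f)
    (hfin : ∫⁻ ω, (∫⁻ s in Ioi (0 : ℝ), ‖f (s.toNNReal, ω)‖ₑ * ENNReal.ofReal (lam s.toNNReal ω)) ∂P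
      ≠ ∞) {φ : ℝ → ℝ} (hφ : Measurable φ) (hφν : Integrable φ ν) :
    Integrable (fun ω => ∑' n, atEvent T f n ω * φ (X n ω)) P ∧
    ∫ ω, ∑' n, atEvent T f n ω * φ (X n ω) ∂P = (∫ x, φ x ∂ν) *
      ∫ ω, (∫ s in Ioi (0 : ℝ), f (s.toNNReal, ω) * lam s.toNNReal ω) ∂P := by
  have hfe : Measurable[𝓕.predictable] fun p => ‖f p‖ₑ := measurable_enorm.comp hf
  have hm : ∀ n, Measurable fun ω => atEvent T f n ω * φ (X n ω) := fun n =>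
    (measurable_atEvent hT hf n).mul (hφ.comp (hX.measurable n))
  have hae : ∀ n ω, ‖atEvent T f n ω * φ (X n ω)‖ₑ =
      atEvent T (fun p => ‖f p‖ₑ) n ω * ‖φ (X n ω)‖ₑ := by
    intro n ω
    rw [enorm_mul]
    congr 1
    simp only [atEvent]
    split_ifs <;> simp
  have htot : ∫⁻ ω, ∑' n, ‖atEvent T f n ω * φ (X n ω)‖ₑ ∂P ≠ ∞ := by
    simp only [hae]
    rw [lintegral_tsum_atEvent_mul hT hX hI hfe (φ := fun x => ‖φ x‖ₑ) hφ.enorm]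
    exact ENNReal.mul_ne_top hφν.2.ne hfin
  refine ⟨⟨(Measurable.tsum hm).aestronglyMeasurable, lt_of_le_of_lt (lintegral_mono fun ω =>
    enorm_tsum_le_tsum_enorm) htot.lt_top⟩, ?_⟩
  rw [integral_tsum (fun n => (hm n).aestronglyMeasurable)
    (by rwa [← lintegral_tsum fun n => (hm n).enorm.aemeasurable])]
  simp only [integral_atEvent_mul hT hX hf hφ]
  rw [tsum_mul_right, (hasSum_integral_atEvent hT hI hf hfin).tsum_eq, mul_comm]

end Jump

/-! ### Pathwise formulas for a self-exciting process -/

variable {α lam₀ β init : ℝ}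

/-- The restriction `1{s ≤ t} f(s)` of a process to the time interval `[0, t]`. -/
noncomputable def window {E : Type*} [Zero E] (t : ℝ≥0) (f : ℝ≥0 × Ω → E) (p : ℝ≥0 × Ω) : E :=
  if p.1 ≤ t then f p else 0

/-- The total size `∑_{T_k < s} X_k` of the jumps strictly before `s`. -/
noncomputable def jumpsBefore (T : ℕ → Ω → WithTop ℝ≥0) (X : ℕ → Ω → ℝ) (p : ℝ≥0 × Ω) : ℝ :=
  ∑' k, if T k p.2 < p.1 then X k p.2 else 0

/-- The predictable version `init + α (λ₀ s - Λ(s)) + β U(s-)` of the intensity, i.e. its left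
limit. -/
noncomputable def leftIntensity (α lam₀ β init : ℝ) (T : ℕ → Ω → WithTop ℝ≥0) (X : ℕ → Ω → ℝ)
    (lam : ℝ≥0 → Ω → ℝ) (p : ℝ≥0 × Ω) : ℝ :=
  init + α * (lam₀ * p.1 - integratedIntensity lam p.1 p.2) + β * jumpsBefore T X p

theorem measurable_window {E : Type*} [MeasurableSpace E] [Zero E] (t : ℝ≥0) {f : ℝ≥0 × Ω → E}
    (hf : Measurable[𝓕.predictable] f) : Measurable[𝓕.predictable] (window t f) :=
  @Measurable.ite _ _ _ _ 𝓕.predictable _ (fun p => p.1 ≤ t) _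
    (measurable_fst_predictable measurableSet_Iic) hf
    measurable_const

theorem measurable_jumpsBefore (hT : IsPointProcess P 𝓕 T) (hX : HasJumpLaw P 𝓕 T X ν) :
    Measurable[𝓕.predictable] (jumpsBefore T X) :=
  @Measurable.tsum _ _ _ 𝓕.predictable _ _ _ _ _ _ _ _ _ _ _ _ fun k =>
    measurable_jump_predictable (hT.isStoppingTime k) (hX.adapted k)

theorem measurable_leftIntensity (hT : IsPointProcess P 𝓕 T) (hX : HasJumpLaw P 𝓕 T X ν)
    (hI : IsIntensity P 𝓕 T lam) :
    Measurable[𝓕.predictable] (leftIntensity α lam₀ β init T X lam) := by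
  have h1 := measurable_integral_predictable hI.adapted hI.rightContinuous
  have h2 : Measurable[𝓕.predictable] fun p : ℝ≥0 × Ω => (p.1 : ℝ) :=
    measurable_coe_nnreal_real.comp measurable_fst_predictable
  exact (((h2.const_mul lam₀).sub h1).const_mul α |>.const_add init).add
    ((measurable_jumpsBefore hT hX).const_mul β)

theorem IsIntensity.isCadlag (hI : IsIntensity P 𝓕 T lam) (ω : Ω) :
    IsCadlag fun s : ℝ => lam s.toNNReal ω := by
  refine ⟨fun s => (hI.rightContinuous ω _).tendsto.comp (tendsto_toNNReal_nhdsGE s), fun s => ?_⟩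
  rcases le_or_gt s 0 with hs | hs
  · refine ⟨lam 0 ω, tendsto_const_nhds.congr' ?_⟩
    filter_upwards [self_mem_nhdsWithin] with r hr
    rw [Real.toNNReal_of_nonpos ((le_of_lt hr).trans hs)]
  · obtain ⟨l, hl⟩ := hI.leftLimits ω s.toNNReal
    refine ⟨l, hl.comp (tendsto_nhdsWithin_iff.2
      ⟨(continuous_real_toNNReal.tendsto s).mono_left nhdsWithin_le_nhds, ?_⟩)⟩
    filter_upwards [self_mem_nhdsWithin] with r hr
    exact (Real.toNNReal_lt_toNNReal_iff hs).2 hr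

theorem le_coe_iff {τ : WithTop ℝ≥0} {t : ℝ≥0} :
    τ ≤ (t : WithTop ℝ≥0) ↔ τ < ⊤ ∧ τ.untopD 0 ≤ t := by
  constructor
  · intro h
    have h1 : τ < ⊤ := h.trans_lt (WithTop.coe_lt_top t)
    obtain ⟨r, rfl⟩ := WithTop.ne_top_iff_exists.1 h1.ne
    exact ⟨h1, WithTop.coe_le_coe.1 h⟩
  · rintro ⟨h1, h2⟩
    obtain ⟨r, rfl⟩ := WithTop.ne_top_iff_exists.1 h1.ne
    exact WithTop.coe_le_coe.2 h2

section Events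

variable {ω : Ω}

/-- As the event times increase, those up to `t` are the first `N(t)` ones. -/
theorem le_iff_lt_count (hmono : Monotone fun n => T n ω)
    (hfin : ∀ t : ℝ≥0, {n : ℕ | T n ω ≤ (t : WithTop ℝ≥0)}.Finite) (t : ℝ≥0) (k : ℕ) :
    T k ω ≤ (t : WithTop ℝ≥0) ↔ k < count T t ω := by
  have hlow : ∀ {i j : ℕ}, i ≤ j → T j ω ≤ (t : WithTop ℝ≥0) → T i ω ≤ (t : WithTop ℝ≥0) :=
    fun hij h => (hmono hij).trans h
  unfold count
  constructor
  · intro h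
    have hsub : (Finset.range (k + 1) : Set ℕ) ⊆ {n : ℕ | T n ω ≤ (t : WithTop ℝ≥0)} := by
      intro j hj
      exact hlow (Nat.lt_succ_iff.1 (by simpa using hj)) h
    have := Set.ncard_le_ncard hsub (hfin t)
    rw [Set.ncard_coe_finset, Finset.card_range] at this
    exact this
  · intro h
    by_contra hk
    have hsub : {n : ℕ | T n ω ≤ (t : WithTop ℝ≥0)} ⊆ (Finset.range k : Set ℕ) := by
      intro j hj
      simp only [Finset.coe_range, mem_Iio]
      by_contra hjk
      exact hk (hlow (not_lt.1 hjk) hj)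
    have := Set.ncard_le_ncard hsub (Finset.finite_toSet _)
    rw [Set.ncard_coe_finset, Finset.card_range] at this
    exact absurd h (not_lt.2 this)

theorem untopD_le_of_lt_count (hmono : Monotone fun n => T n ω)
    (hfin : ∀ t : ℝ≥0, {n : ℕ | T n ω ≤ (t : WithTop ℝ≥0)}.Finite) {t : ℝ≥0} {k : ℕ}
    (hk : k < count T t ω) : T k ω < ⊤ ∧ (T k ω).untopD 0 ≤ t :=
  le_coe_iff.1 ((le_iff_lt_count hmono hfin t k).2 hk)

theorem jumpProcess_eq_sum (hmono : Monotone fun n => T n ω)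
    (hfin : ∀ t : ℝ≥0, {n : ℕ | T n ω ≤ (t : WithTop ℝ≥0)}.Finite) {s t : ℝ≥0} (hst : s ≤ t) :
    jumpProcess T X s ω =
      ∑ k ∈ Finset.range (count T t ω), if (T k ω).untopD 0 ≤ s then X k ω else 0 := by
  rw [jumpProcess, ← Finset.sum_filter]
  refine Finset.sum_congr ?_ fun _ _ => rfl
  ext k
  simp only [Finset.mem_range, Finset.mem_filter]
  rw [← le_iff_lt_count hmono hfin, ← le_iff_lt_count hmono hfin, le_coe_iff, le_coe_iff]
  exact ⟨fun h => ⟨⟨h.1, h.2.trans hst⟩, h.2⟩, fun h => ⟨h.1.1, h.2⟩⟩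

theorem tsum_atEvent_window (hmono : Monotone fun n => T n ω)
    (hfin : ∀ t : ℝ≥0, {n : ℕ | T n ω ≤ (t : WithTop ℝ≥0)}.Finite) (t : ℝ≥0)
    (f : ℝ≥0 × Ω → ℝ) (y : ℕ → ℝ) :
    ∑' n, atEvent T (window t f) n ω * y n =
      ∑ k ∈ Finset.range (count T t ω), f ((T k ω).untopD 0, ω) * y k := by
  rw [tsum_eq_sum (s := Finset.range (count T t ω))]
  · refine Finset.sum_congr rfl fun k hk => ?_
    have := untopD_le_of_lt_count hmono hfin (Finset.mem_range.1 hk)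
    simp only [atEvent, window]
    rw [if_pos this.1, if_pos this.2]
  · intro k hk
    rw [Finset.mem_range, ← le_iff_lt_count hmono hfin, le_coe_iff, not_and] at hk
    simp only [atEvent, window]
    split_ifs with h1 h2
    · exact absurd h2 (hk h1)
    · simp
    · simp

theorem jumpsBefore_atEvent (hmono : Monotone fun n => T n ω)
    (hsimple : ∀ n, T n ω < ⊤ → T n ω < T (n + 1) ω) {k : ℕ} (hk : T k ω < ⊤) :
    jumpsBefore T X ((T k ω).untopD 0, ω) = ∑ j ∈ Finset.range k, X j ω := by
  obtain ⟨r, hr⟩ := WithTop.ne_top_iff_exists.1 hk.ne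
  have hiff : ∀ j, T j ω < T k ω ↔ j < k := by
    intro j
    constructor
    · intro h
      by_contra hjk
      exact absurd h (not_lt.2 (hmono (not_lt.1 hjk)))
    · intro h
      exact (hsimple j ((hmono h.le).trans_lt hk)).trans_le (hmono h)
  have hc : (((T k ω).untopD 0 : ℝ≥0) : WithTop ℝ≥0) = T k ω := by
    rw [← hr]; rfl
  unfold jumpsBefore
  simp only
  rw [tsum_eq_sum (s := Finset.range k)]
  · refine Finset.sum_congr rfl fun j hj => if_pos ?_
    exact lt_of_lt_of_eq ((hiff j).2 (Finset.mem_range.1 hj)) hc.symm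
  · intro j hj
    exact if_neg fun h => hj (Finset.mem_range.2 ((hiff j).1 (lt_of_lt_of_eq h hc)))

theorem jumpsBefore_eq_jumpProcess (hmono : Monotone fun n => T n ω)
    (hfin : ∀ t : ℝ≥0, {n : ℕ | T n ω ≤ (t : WithTop ℝ≥0)}.Finite) {s : ℝ≥0}
    (hs : ∀ n, T n ω ≠ (s : WithTop ℝ≥0)) : jumpsBefore T X (s, ω) = jumpProcess T X s ω := by
  unfold jumpsBefore
  simp only
  rw [jumpProcess, tsum_eq_sum (s := Finset.range (count T s ω))]
  · refine Finset.sum_congr rfl fun j hj => if_pos ?_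
    exact lt_of_le_of_ne ((le_iff_lt_count hmono hfin s j).2 (Finset.mem_range.1 hj)) (hs j)
  · intro j hj
    exact if_neg fun h => hj (Finset.mem_range.2 ((le_iff_lt_count hmono hfin s j).1 h.le))

end Events

/-- The almost sure properties of the paths of a linear self-exciting process. -/
structure IsGoodPath (T : ℕ → Ω → WithTop ℝ≥0) (X : ℕ → Ω → ℝ) (lam : ℝ≥0 → Ω → ℝ)
    (α lam₀ β init : ℝ) (ω : Ω) : Prop where
  cadlag : IsCadlag fun s : ℝ => lam s.toNNReal ω
  nonneg : ∀ t, 0 ≤ lam t ω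
  mono : Monotone fun n => T n ω
  simple : ∀ n, T n ω < ⊤ → T n ω < T (n + 1) ω
  fin : ∀ t : ℝ≥0, {n : ℕ | T n ω ≤ (t : WithTop ℝ≥0)}.Finite
  sde : ∀ t : ℝ≥0, lam t ω = init + (∫ s in (0 : ℝ)..t, α * (lam₀ - lam s.toNNReal ω)) +
    β * jumpProcess T X t ω

theorem IsLinearSelfExciting.ae_isGoodPath
    (hp : IsLinearSelfExciting P 𝓕 α lam₀ β init ν T X lam) :
    ∀ᵐ ω ∂P, IsGoodPath T X lam α lam₀ β init ω := by
  filter_upwards [hp.intensity.nonneg, hp.pointProcess.simple, hp.pointProcess.finite, hp.sde]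
    with ω h1 h2 h3 h4
  exact ⟨hp.intensity.isCadlag ω, h1, hp.pointProcess.monotone ω, h2, h3, h4⟩

namespace IsGoodPath

variable {ω : Ω} (h : IsGoodPath T X lam α lam₀ β init ω)
include h

theorem integral_drift (t : ℝ) :
    ∫ s in (0 : ℝ)..t, α * (lam₀ - lam s.toNNReal ω) =
      α * (lam₀ * t - ∫ s in (0 : ℝ)..t, lam s.toNNReal ω) := by
  rw [intervalIntegral.integral_const_mul, intervalIntegral.integral_sub
    intervalIntegrable_const (h.cadlag.intervalIntegrable 0 t)]
  simp [mul_comm]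

theorem jumpProcess_eq_tsum (t : ℝ≥0) :
    jumpProcess T X t ω = ∑' n, atEvent T (window t fun _ => 1) n ω * X n ω := by
  rw [tsum_atEvent_window h.mono h.fin]
  simp [jumpProcess]

theorem eq_init_add (t : ℝ≥0) :
    lam t ω = init + α * (lam₀ * t - integratedIntensity lam t ω) +
      β * ∑' n, atEvent T (window t fun _ => 1) n ω * X n ω := by
  rw [← h.jumpProcess_eq_tsum, h.sde t, h.integral_drift]
  rfl

theorem sde_window (t : ℝ≥0) : ∀ s ∈ Icc (0 : ℝ) t, lam s.toNNReal ω =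
    init + (∫ r in (0 : ℝ)..s, α * (lam₀ - lam r.toNNReal ω)) +
      β * ∑ k ∈ Finset.range (count T t ω),
        if (((T k ω).untopD 0 : ℝ≥0) : ℝ) ≤ s then X k ω else 0 := by
  intro s hs
  lift s to ℝ≥0 using hs.1
  rw [Real.toNNReal_coe, h.sde s, jumpProcess_eq_sum h.mono h.fin (NNReal.coe_le_coe.1 hs.2)]
  simp

theorem events_mem (t : ℝ≥0) : ∀ k ∈ Finset.range (count T t ω),
    0 ≤ (((T k ω).untopD 0 : ℝ≥0) : ℝ) ∧ (((T k ω).untopD 0 : ℝ≥0) : ℝ) ≤ t := fun _ hk =>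
  ⟨NNReal.coe_nonneg _, NNReal.coe_le_coe.2
    (untopD_le_of_lt_count h.mono h.fin (Finset.mem_range.1 hk)).2⟩

theorem leftIntensity_atEvent {k : ℕ} (hk : T k ω < ⊤) :
    leftIntensity α lam₀ β init T X lam ((T k ω).untopD 0, ω) =
      init + (∫ r in (0 : ℝ)..((T k ω).untopD 0 : ℝ≥0), α * (lam₀ - lam r.toNNReal ω)) +
        β * ∑ j ∈ Finset.range k, X j ω := by
  rw [leftIntensity, jumpsBefore_atEvent h.mono h.simple hk, h.integral_drift]
  rfl

/-- The left limit of the intensity differs from the intensity at most at the countably many event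
times. -/
theorem leftIntensity_ae_eq :
    ∀ᵐ s ∂(volume.restrict (Ioi (0 : ℝ))),
      leftIntensity α lam₀ β init T X lam (s.toNNReal, ω) = lam s.toNNReal ω := by
  have hcount : ∀ᵐ s : ℝ, s ∉ range fun n => (((T n ω).untopD 0 : ℝ≥0) : ℝ) :=
    (countable_range _).ae_notMem _
  filter_upwards [ae_restrict_of_ae hcount, ae_restrict_mem measurableSet_Ioi] with s hs hs0
  have hne : ∀ n, T n ω ≠ (s.toNNReal : WithTop ℝ≥0) := by
    intro n hn
    refine hs ⟨n, ?_⟩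
    simp only
    rw [hn, WithTop.untopD_coe, Real.coe_toNNReal _ (le_of_lt hs0)]
  rw [leftIntensity, jumpsBefore_eq_jumpProcess h.mono h.fin hne, h.sde s.toNNReal,
    h.integral_drift]
  rfl

theorem sq_eq (t : ℝ≥0) :
    lam t ω ^ 2 = init ^ 2 +
      2 * (∫ s in (0 : ℝ)..t, lam s.toNNReal ω * (α * (lam₀ - lam s.toNNReal ω))) +
      2 * β * (∑' n, atEvent T (window t (leftIntensity α lam₀ β init T X lam)) n ω * X n ω) +
      β ^ 2 * ∑' n, atEvent T (window t fun _ => 1) n ω * X n ω ^ 2 := by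
  have key := path_sq h.cadlag t.2 (h.events_mem t) (h.sde_window t)
  simp only [NNReal.val_eq_coe, Real.toNNReal_coe] at key
  rw [key, tsum_atEvent_window h.mono h.fin,
    tsum_atEvent_window h.mono h.fin (y := fun n => X n ω ^ 2),
    Finset.mul_sum (a := 2 * β), Finset.mul_sum (a := β ^ 2), add_assoc (init ^ 2 + _),
    ← Finset.sum_add_distrib]
  congr 1
  refine Finset.sum_congr rfl fun k hk => ?_
  rw [h.leftIntensity_atEvent (untopD_le_of_lt_count h.mono h.fin (Finset.mem_range.1 hk)).1]
  ring

theorem integratedIntensity_mul_eq (t : ℝ≥0) :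
    integratedIntensity lam t ω * lam t ω =
      (∫ s in (0 : ℝ)..t, (lam s.toNNReal ω ^ 2 +
        integratedIntensity lam s.toNNReal ω * (α * (lam₀ - lam s.toNNReal ω)))) +
      β * ∑' n, atEvent T (window t fun p => integratedIntensity lam p.1 p.2) n ω * X n ω := by
  have key := primitive_mul_path h.cadlag t.2 (h.events_mem t) (h.sde_window t) h.cadlag 0
  simp only [NNReal.val_eq_coe, Real.toNNReal_coe, zero_add, zero_mul] at key
  rw [tsum_atEvent_window h.mono h.fin]
  unfold integratedIntensity
  rw [key]
  congr 1
  refine intervalIntegral.integral_congr fun s hs => ?_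
  rw [uIcc_of_le t.coe_nonneg] at hs
  simp only [Real.coe_toNNReal s hs.1]
  ring

theorem integratedIntensity_sq (t : ℝ≥0) :
    integratedIntensity lam t ω ^ 2 =
      2 * ∫ s in (0 : ℝ)..t, integratedIntensity lam s.toNNReal ω * lam s.toNNReal ω := by
  have key := h.cadlag.primitive_mul_primitive h.cadlag 0 0 t
  simp only [zero_add, zero_mul] at key
  unfold integratedIntensity
  rw [sq, key, ← intervalIntegral.integral_const_mul]
  refine intervalIntegral.integral_congr fun s hs => ?_
  rw [uIcc_of_le t.coe_nonneg] at hs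
  simp only [Real.coe_toNNReal s hs.1]
  ring

theorem integratedIntensity_nonneg (t : ℝ≥0) : 0 ≤ integratedIntensity lam t ω :=
  intervalIntegral.integral_nonneg t.2 fun _ _ => h.nonneg _

end IsGoodPath

/-! ### Boundedness of the first moment -/

/-- The indicator of the stochastic interval `{(s, ω) : s ≤ T_n(ω)}`. -/
noncomputable def upToEvent (T : ℕ → Ω → WithTop ℝ≥0) (n : ℕ) (p : ℝ≥0 × Ω) : ℝ≥0∞ :=
  if (p.1 : WithTop ℝ≥0) ≤ T n p.2 then 1 else 0

theorem measurable_upToEvent (hT : IsPointProcess P 𝓕 T) (n : ℕ) :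
    Measurable[𝓕.predictable] (upToEvent T n) :=
  @Measurable.ite _ _ _ _ 𝓕.predictable _ (fun p => (p.1 : WithTop ℝ≥0) ≤ T n p.2) _
    (measurableSet_predictable_le (hT.isStoppingTime n)) measurable_const measurable_const

theorem upToEvent_le_one (n : ℕ) (p : ℝ≥0 × Ω) : upToEvent T n p ≤ 1 := by
  unfold upToEvent; split_ifs <;> simp

theorem lintegral_window_mul (t : ℝ≥0) (f : ℝ≥0 × Ω → ℝ≥0∞) (g : ℝ → ℝ≥0∞) (ω : Ω) :
    ∫⁻ s in Ioi (0 : ℝ), window t f (s.toNNReal, ω) * g s =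
      ∫⁻ s in Ioc (0 : ℝ) t, f (s.toNNReal, ω) * g s := by
  rw [← lintegral_indicator measurableSet_Ioi, ← lintegral_indicator measurableSet_Ioc]
  congr 1
  ext s
  by_cases h0 : 0 < s
  · by_cases ht : s ≤ t
    · simp [h0, ht, window, Real.toNNReal_le_iff_le_coe]
    · simp [h0, ht, window, Real.toNNReal_le_iff_le_coe]
  · simp [h0]

section

variable [IsFiniteMeasure P]

theorem lintegral_lintegral_window_mul (hI : IsIntensity P 𝓕 T lam) (t : ℝ≥0)
    {f : ℝ≥0 × Ω → ℝ≥0∞} (hf : Measurable[𝓕.predictable] f) :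
    ∫⁻ ω, (∫⁻ s in Ioi (0 : ℝ), window t f (s.toNNReal, ω) * ENNReal.ofReal (lam s.toNNReal ω)) ∂P =
      ∫⁻ s in Ioc (0 : ℝ) t, ∫⁻ ω, f (s.toNNReal, ω) * ENNReal.ofReal (lam s.toNNReal ω) ∂P := by
  simp only [lintegral_window_mul]
  exact lintegral_lintegral_swap
    ((measurable_comp_predictable hf).mul hI.measurable_path.ennreal_ofReal).aemeasurable

omit [IsFiniteMeasure P] in
/-- Gronwall's inequality up to the `n`-th event, followed by `n → ∞`. -/
theorem lintegral_le_of_localized (hT : IsPointProcess P 𝓕 T) {Z : ℝ≥0 × Ω → ℝ≥0∞}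
    (hZ : ∀ s, Measurable fun ω => Z (s, ω)) {t : ℝ≥0} {B : ℝ≥0∞} (hB : B ≠ ∞) (K : ℝ≥0)
    (hfin : ∀ n, ∫⁻ s in Ioc (0 : ℝ) t, ∫⁻ ω, upToEvent T n (s.toNNReal, ω) *
      Z (s.toNNReal, ω) ∂P ≠ ∞)
    (hle : ∀ n, ∀ s ≤ t, ∫⁻ ω, upToEvent T n (s, ω) * Z (s, ω) ∂P ≤
      B + K * ∫⁻ r in Ioc (0 : ℝ) s, ∫⁻ ω, upToEvent T n (r.toNNReal, ω) * Z (r.toNNReal, ω) ∂P)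
    {s : ℝ≥0} (hs : s ≤ t) :
    ∫⁻ ω, Z (s, ω) ∂P ≤ 2 * B * ENNReal.ofReal (Real.exp ((2 * K + 1) * t)) := by
  have hn : ∀ n, ∫⁻ ω, upToEvent T n (s, ω) * Z (s, ω) ∂P ≤
      2 * B * ENNReal.ofReal (Real.exp ((2 * K + 1) * t)) := by
    intro n
    have := le_of_le_add_mul_lintegral (u := fun s => ∫⁻ ω, upToEvent T n (s.toNNReal, ω) *
      Z (s.toNNReal, ω) ∂P) (t := t) hB (hfin n) (fun r hr => by
        lift r to ℝ≥0 using hr.1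
        simpa using hle n r (NNReal.coe_le_coe.1 hr.2)) s ⟨s.coe_nonneg, NNReal.coe_le_coe.2 hs⟩
    simpa using this
  have hmeas : ∀ n, Measurable fun ω => upToEvent T n (s, ω) * Z (s, ω) := fun n =>
    (((measurable_upToEvent hT n).mono predictable_le_prod le_rfl).comp
      measurable_prodMk_left).mul (hZ s)
  have hmono : Monotone fun n ω => upToEvent T n (s, ω) * Z (s, ω) := by
    intro i j hij ω
    simp only
    gcongr ?_ * _
    unfold upToEvent
    split_ifs with h1 h2
    · exact le_rfl
    · exact absurd (le_trans h1 (hT.monotone ω hij)) h2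
    · exact zero_le_one
    · exact le_rfl
  calc ∫⁻ ω, Z (s, ω) ∂P ≤ ∫⁻ ω, ⨆ n, upToEvent T n (s, ω) * Z (s, ω) ∂P := by
        refine lintegral_mono_ae ?_
        filter_upwards [hT.finite] with ω hω
        obtain ⟨n, hnω⟩ := (hω s).exists_notMem
        refine le_iSup_of_le n ?_
        have : upToEvent T n (s, ω) = 1 := if_pos (le_of_lt (not_le.1 hnω))
        rw [this, one_mul]
    _ = ⨆ n, ∫⁻ ω, upToEvent T n (s, ω) * Z (s, ω) ∂P := lintegral_iSup hmeas hmono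
    _ ≤ _ := iSup_le hn

end

theorem upToEvent_mul_lintegral_le (ω : Ω) (n : ℕ) (t : ℝ≥0) (g : ℝ → ℝ≥0∞) :
    upToEvent T n (t, ω) * ∫⁻ s in Ioc (0 : ℝ) t, g s ≤
      ∫⁻ s in Ioc (0 : ℝ) t, upToEvent T n (s.toNNReal, ω) * g s := by
  unfold upToEvent
  split_ifs with ht
  · rw [one_mul]
    refine setLIntegral_mono' measurableSet_Ioc fun s hs => ?_
    have : (s.toNNReal : WithTop ℝ≥0) ≤ T n ω :=
      le_trans (WithTop.coe_le_coe.2 (Real.toNNReal_le_iff_le_coe.2 hs.2)) ht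
    simp only [if_pos this, one_mul, le_refl]
  · simp

theorem upToEvent_mul_tsum_le (ω : Ω) (n : ℕ) (t : ℝ≥0) (f : ℝ≥0 × Ω → ℝ) (y : ℕ → ℝ) :
    upToEvent T n (t, ω) * ‖∑' k, atEvent T (window t f) k ω * y k‖ₑ ≤
      ∑' k, atEvent T (window t fun p => upToEvent T n p * ‖f p‖ₑ) k ω * ‖y k‖ₑ := by
  by_cases ht : (t : WithTop ℝ≥0) ≤ T n ω
  · have h1 : upToEvent T n (t, ω) = 1 := if_pos ht
    rw [h1, one_mul]
    refine enorm_tsum_le_tsum_enorm.trans (ENNReal.tsum_le_tsum fun k => ?_)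
    rw [enorm_mul]
    gcongr ?_ * _
    simp only [atEvent, window]
    split_ifs with h2 h3
    · have : upToEvent T n ((T k ω).untopD 0, ω) = 1 :=
        if_pos (le_trans (WithTop.coe_le_coe.2 h3) ht)
      rw [this, one_mul]
    · simp
    · simp
  · have h1 : upToEvent T n (t, ω) = 0 := if_neg ht
    simp [h1]

namespace IsGoodPath

variable {ω : Ω} (h : IsGoodPath T X lam α lam₀ β init ω)
include h

theorem upToEvent_atEvent (n : ℕ) {k : ℕ} (hk : T k ω < ⊤) :
    upToEvent T n ((T k ω).untopD 0, ω) = if k ≤ n then 1 else 0 := by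
  have hc : (((T k ω).untopD 0 : ℝ≥0) : WithTop ℝ≥0) = T k ω := by
    obtain ⟨r, hr⟩ := WithTop.ne_top_iff_exists.1 hk.ne
    rw [← hr]; rfl
  unfold upToEvent
  split_ifs with h1 h2 h2
  · rfl
  · rw [hc] at h1
    have h3 : T n ω < ⊤ := lt_of_le_of_lt (h.mono (not_le.1 h2).le) hk
    exact absurd h1 (not_le.2 ((h.simple n h3).trans_le (h.mono (not_le.1 h2))))
  · exact absurd (hc.le.trans (h.mono h2)) h1
  · rfl

/-- At most `n + 1` events occur up to the time `T_n`. -/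
theorem tsum_atEvent_upToEvent_mul_le (n : ℕ) {f : ℝ≥0 × Ω → ℝ≥0∞} {t : ℝ≥0} {C : ℝ≥0∞}
    (hC : ∀ k, T k ω ≤ (t : WithTop ℝ≥0) → f ((T k ω).untopD 0, ω) ≤ C) :
    ∑' k, atEvent T (window t fun p => upToEvent T n p * f p) k ω ≤ (n + 1) * C := by
  rw [tsum_eq_sum (s := Finset.range (n + 1))]
  · calc _ ≤ ∑ _k ∈ Finset.range (n + 1), C := by
          refine Finset.sum_le_sum fun k _ => ?_
          simp only [atEvent, window]
          split_ifs with h1 h2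
          · calc _ ≤ 1 * C := by
                  gcongr
                  · exact upToEvent_le_one _ _
                  · exact hC k (le_coe_iff.2 ⟨h1, h2⟩)
              _ = C := one_mul C
          · simp
          · simp
      _ = _ := by simp
  · intro k hk
    simp only [atEvent, window]
    split_ifs with h1 h2
    · rw [h.upToEvent_atEvent n h1,
        if_neg (fun hkn => hk (Finset.mem_range.2 (by omega))), zero_mul]
    · rfl
    · rfl

theorem enorm_integratedIntensity_le (t : ℝ≥0) :
    ‖integratedIntensity lam t ω‖ₑ ≤ ∫⁻ s in Ioc (0 : ℝ) t, ENNReal.ofReal (lam s.toNNReal ω) := by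
  rw [integratedIntensity, intervalIntegral.integral_of_le t.coe_nonneg]
  refine (enorm_integral_le_lintegral_enorm _).trans (le_of_eq ?_)
  refine lintegral_congr fun s => ?_
  rw [Real.enorm_of_nonneg (h.nonneg _)]

theorem upToEvent_mul_intensity_le (n : ℕ) {s t : ℝ≥0} (hst : s ≤ t) :
    upToEvent T n (s, ω) * ENNReal.ofReal (lam s ω) ≤
      ENNReal.ofReal (|init| + |α * lam₀| * t) +
      ‖α‖ₑ * (∫⁻ r in Ioc (0 : ℝ) s, upToEvent T n (r.toNNReal, ω) *
        ENNReal.ofReal (lam r.toNNReal ω)) +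
      ‖β‖ₑ * ∑' k, atEvent T (window s fun p => upToEvent T n p * ‖(1 : ℝ)‖ₑ) k ω * ‖X k ω‖ₑ := by
  have e : ENNReal.ofReal (lam s ω) ≤ ENNReal.ofReal (|init| + |α * lam₀| * t) +
      ‖α‖ₑ * (∫⁻ r in Ioc (0 : ℝ) s, ENNReal.ofReal (lam r.toNNReal ω)) +
      ‖β‖ₑ * ‖∑' k, atEvent T (window s fun _ => (1 : ℝ)) k ω * X k ω‖ₑ := by
    rw [← Real.enorm_of_nonneg (h.nonneg s), h.eq_init_add s]
    refine (enorm_add_le _ _).trans ?_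
    rw [enorm_mul β]
    gcongr ?_ + _
    rw [show init + α * (lam₀ * s - integratedIntensity lam s ω) =
      (init + α * lam₀ * s) + (-α) * integratedIntensity lam s ω by ring]
    refine (enorm_add_le _ _).trans ?_
    rw [enorm_mul, enorm_neg]
    gcongr
    · rw [Real.enorm_eq_ofReal_abs]
      refine ENNReal.ofReal_le_ofReal ((abs_add_le _ _).trans ?_)
      rw [abs_mul _ (s : ℝ), abs_of_nonneg s.coe_nonneg]
      gcongr
    · exact h.enorm_integratedIntensity_le s
  calc _ ≤ upToEvent T n (s, ω) * (ENNReal.ofReal (|init| + |α * lam₀| * t) +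
      ‖α‖ₑ * (∫⁻ r in Ioc (0 : ℝ) s, ENNReal.ofReal (lam r.toNNReal ω)) +
      ‖β‖ₑ * ‖∑' k, atEvent T (window s fun _ => (1 : ℝ)) k ω * X k ω‖ₑ) := by gcongr
    _ = upToEvent T n (s, ω) * ENNReal.ofReal (|init| + |α * lam₀| * t) +
      ‖α‖ₑ * (upToEvent T n (s, ω) *
        ∫⁻ r in Ioc (0 : ℝ) s, ENNReal.ofReal (lam r.toNNReal ω)) +
      ‖β‖ₑ * (upToEvent T n (s, ω) *
        ‖∑' k, atEvent T (window s fun _ => (1 : ℝ)) k ω * X k ω‖ₑ) := by ring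
    _ ≤ 1 * ENNReal.ofReal (|init| + |α * lam₀| * t) +
      ‖α‖ₑ * (∫⁻ r in Ioc (0 : ℝ) s, upToEvent T n (r.toNNReal, ω) *
        ENNReal.ofReal (lam r.toNNReal ω)) +
      ‖β‖ₑ * ∑' k, atEvent T (window s fun p => upToEvent T n p * ‖(1 : ℝ)‖ₑ) k ω * ‖X k ω‖ₑ := by
        gcongr
        · exact upToEvent_le_one _ _
        · exact upToEvent_mul_lintegral_le ω n s _
        · exact upToEvent_mul_tsum_le ω n s _ _
    _ = _ := by rw [one_mul]

end IsGoodPath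

section FirstMoment

variable [IsProbabilityMeasure P] [IsProbabilityMeasure ν]

omit [IsProbabilityMeasure ν] in
/-- The expected number of events up to `T_n` is finite, hence so is the localized integral of the
intensity. -/
theorem lintegral_window_upToEvent_ne_top
    (hp : IsLinearSelfExciting P 𝓕 α lam₀ β init ν T X lam) (t : ℝ≥0) (n : ℕ) :
    ∫⁻ s in Ioc (0 : ℝ) t, ∫⁻ ω, upToEvent T n (s.toNNReal, ω) *
      ENNReal.ofReal (lam s.toNNReal ω) ∂P ≠ ∞ := by
  have hm := measurable_upToEvent hp.pointProcess n
  rw [← lintegral_lintegral_window_mul hp.intensity t hm,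
    ← hp.intensity.lintegral_eq _ (measurable_window t hm)]
  refine ne_top_of_le_ne_top (b := ∫⁻ _ω, ((n : ℝ≥0∞) + 1) * 1 ∂P) (by simp) ?_
  refine lintegral_mono_ae ?_
  filter_upwards [hp.ae_isGoodPath] with ω hω
  have := hω.tsum_atEvent_upToEvent_mul_le n (f := fun _ => 1) (t := t) (C := 1) (fun _ _ => le_rfl)
  simpa [integralCount, atEvent] using this

theorem exists_lintegral_intensity_le
    (hp : IsLinearSelfExciting P 𝓕 α lam₀ β init ν T X lam) (hν : Integrable (fun x : ℝ => x) ν)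
    (t : ℝ≥0) : ∃ B : ℝ≥0∞, B ≠ ∞ ∧ ∀ s ≤ t, ∫⁻ ω, ENNReal.ofReal (lam s ω) ∂P ≤ B := by
  have hlam : ∀ s, Measurable (lam s) := fun s => (hp.intensity.adapted s).mono (𝓕.le s) le_rfl
  set q : ℝ≥0 := (∫⁻ x, ‖x‖ₑ ∂ν).toNNReal with hq
  have hq' : ∫⁻ x, ‖x‖ₑ ∂ν = q := (ENNReal.coe_toNNReal hν.2.ne).symm
  refine ⟨_, ?_, fun s hs => lintegral_le_of_localized hp.pointProcess
    (Z := fun p => ENNReal.ofReal (lam p.1 p.2)) (fun s => (hlam s).ennreal_ofReal)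
    (B := ENNReal.ofReal (|init| + |α * lam₀| * t)) ENNReal.ofReal_ne_top (‖α‖₊ + ‖β‖₊ * q)
    (lintegral_window_upToEvent_ne_top hp t) ?_ hs⟩
  · finiteness
  intro n s hs
  have hm := measurable_upToEvent hp.pointProcess n
  have hm1 : Measurable[𝓕.predictable] fun p => upToEvent T n p * ‖(1 : ℝ)‖ₑ := hm.mul_const _
  have hswap : ∫⁻ ω, (∫⁻ r in Ioc (0 : ℝ) s, upToEvent T n (r.toNNReal, ω) *
        ENNReal.ofReal (lam r.toNNReal ω)) ∂P =
      ∫⁻ r in Ioc (0 : ℝ) s, ∫⁻ ω, upToEvent T n (r.toNNReal, ω) *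
        ENNReal.ofReal (lam r.toNNReal ω) ∂P := by
    rw [← lintegral_lintegral_window_mul hp.intensity s hm]
    simp only [lintegral_window_mul]
  have hjump := lintegral_tsum_atEvent_mul hp.pointProcess hp.jumpLaw hp.intensity
    (measurable_window s hm1) (φ := fun x => ‖x‖ₑ) measurable_enorm
  rw [lintegral_lintegral_window_mul hp.intensity s hm1, hq'] at hjump
  simp only [enorm_one, mul_one] at hjump
  have hmi : Measurable fun ω => ∫⁻ r in Ioc (0 : ℝ) s, upToEvent T n (r.toNNReal, ω) *
        ENNReal.ofReal (lam r.toNNReal ω) :=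
    ((measurable_comp_predictable hm).mul
      hp.intensity.measurable_path.ennreal_ofReal).lintegral_prod_right'
  have hma : Measurable fun ω => ENNReal.ofReal (|init| + |α * lam₀| * t) +
      ‖α‖ₑ * (∫⁻ r in Ioc (0 : ℝ) s, upToEvent T n (r.toNNReal, ω) *
        ENNReal.ofReal (lam r.toNNReal ω)) := measurable_const.add (hmi.const_mul _)
  calc _ ≤ ∫⁻ ω, (ENNReal.ofReal (|init| + |α * lam₀| * t) +
      ‖α‖ₑ * (∫⁻ r in Ioc (0 : ℝ) s, upToEvent T n (r.toNNReal, ω) *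
        ENNReal.ofReal (lam r.toNNReal ω)) +
      ‖β‖ₑ * ∑' k, atEvent T (window s fun p => upToEvent T n p * ‖(1 : ℝ)‖ₑ) k ω *
        ‖X k ω‖ₑ) ∂P := by
        refine lintegral_mono_ae ?_
        filter_upwards [hp.ae_isGoodPath] with ω hω
        exact hω.upToEvent_mul_intensity_le n hs
    _ = _ := by
        rw [lintegral_add_left hma,
          lintegral_add_left measurable_const, lintegral_const_mul _ hmi, hswap,
          lintegral_const_mul' _ _ (by finiteness)]
        simp only [enorm_one, mul_one]
        rw [hjump, lintegral_const, measure_univ]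
        push_cast
        simp only [enorm_eq_nnnorm]
        ring

end FirstMoment

/-! ### Boundedness of the second moment -/

namespace IsGoodPath

variable {ω : Ω} (h : IsGoodPath T X lam α lam₀ β init ω)
include h

theorem upToEvent_mul_sq_le (n : ℕ) (s : ℝ≥0) :
    upToEvent T n (s, ω) * ENNReal.ofReal (lam s ω ^ 2) ≤
      ENNReal.ofReal (init ^ 2) +
      2 * ‖α * lam₀‖ₑ * (∫⁻ r in Ioc (0 : ℝ) s, upToEvent T n (r.toNNReal, ω) *
        ENNReal.ofReal (lam r.toNNReal ω)) +
      2 * ‖α‖ₑ * (∫⁻ r in Ioc (0 : ℝ) s, upToEvent T n (r.toNNReal, ω) *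
        ENNReal.ofReal (lam r.toNNReal ω ^ 2)) +
      2 * ‖β‖ₑ * (∑' k, atEvent T (window s fun p => upToEvent T n p *
        ‖leftIntensity α lam₀ β init T X lam p‖ₑ) k ω * ‖X k ω‖ₑ) +
      ‖β‖ₑ ^ 2 * ∑' k, atEvent T (window s fun p => upToEvent T n p * ‖(1 : ℝ)‖ₑ) k ω *
        ‖X k ω ^ 2‖ₑ := by
  have hlm : Measurable fun r : ℝ => ENNReal.ofReal (lam r.toNNReal ω) :=
    h.cadlag.measurable.ennreal_ofReal
  have hdrift : ‖∫ r in (0 : ℝ)..s, lam r.toNNReal ω * (α * (lam₀ - lam r.toNNReal ω))‖ₑ ≤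
      ‖α * lam₀‖ₑ * (∫⁻ r in Ioc (0 : ℝ) s, ENNReal.ofReal (lam r.toNNReal ω)) +
      ‖α‖ₑ * ∫⁻ r in Ioc (0 : ℝ) s, ENNReal.ofReal (lam r.toNNReal ω ^ 2) := by
    rw [intervalIntegral.integral_of_le s.coe_nonneg]
    refine (enorm_integral_le_lintegral_enorm _).trans ?_
    rw [← lintegral_const_mul' _ _ (by finiteness), ← lintegral_const_mul' _ _ (by finiteness),
      ← lintegral_add_left (hlm.const_mul _)]
    refine lintegral_mono fun r => ?_
    rw [← Real.enorm_of_nonneg (h.nonneg _), ← Real.enorm_of_nonneg (sq_nonneg (lam r.toNNReal ω)),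
      ← enorm_mul, ← enorm_mul, ← enorm_neg (α * lam r.toNNReal ω ^ 2),
      show lam r.toNNReal ω * (α * (lam₀ - lam r.toNNReal ω)) =
        α * lam₀ * lam r.toNNReal ω + -(α * lam r.toNNReal ω ^ 2) by ring]
    exact enorm_add_le _ _
  have h2 : ‖(2 : ℝ)‖ₑ = 2 := by
    rw [Real.enorm_of_nonneg (by norm_num)]; simp
  have e : ENNReal.ofReal (lam s ω ^ 2) ≤ ENNReal.ofReal (init ^ 2) +
      2 * ‖α * lam₀‖ₑ * (∫⁻ r in Ioc (0 : ℝ) s, ENNReal.ofReal (lam r.toNNReal ω)) +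
      2 * ‖α‖ₑ * (∫⁻ r in Ioc (0 : ℝ) s, ENNReal.ofReal (lam r.toNNReal ω ^ 2)) +
      2 * ‖β‖ₑ * ‖∑' k, atEvent T (window s (leftIntensity α lam₀ β init T X lam)) k ω * X k ω‖ₑ +
      ‖β‖ₑ ^ 2 * ‖∑' k, atEvent T (window s fun _ => (1 : ℝ)) k ω * X k ω ^ 2‖ₑ := by
    rw [← Real.enorm_of_nonneg (sq_nonneg (lam s ω)), h.sq_eq s,
      ← Real.enorm_of_nonneg (sq_nonneg init)]
    refine (enorm_add_le _ _).trans ?_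
    rw [enorm_mul (β ^ 2), enorm_pow]
    gcongr ?_ + _
    refine (enorm_add_le _ _).trans ?_
    rw [enorm_mul (2 * β), enorm_mul 2 β, h2]
    gcongr ?_ + _
    refine (enorm_add_le _ _).trans ?_
    rw [enorm_mul, h2, add_assoc, mul_assoc, mul_assoc, ← mul_add]
    gcongr
  calc _ ≤ upToEvent T n (s, ω) * (ENNReal.ofReal (init ^ 2) +
      2 * ‖α * lam₀‖ₑ * (∫⁻ r in Ioc (0 : ℝ) s, ENNReal.ofReal (lam r.toNNReal ω)) +
      2 * ‖α‖ₑ * (∫⁻ r in Ioc (0 : ℝ) s, ENNReal.ofReal (lam r.toNNReal ω ^ 2)) +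
      2 * ‖β‖ₑ * ‖∑' k, atEvent T (window s (leftIntensity α lam₀ β init T X lam)) k ω * X k ω‖ₑ +
      ‖β‖ₑ ^ 2 * ‖∑' k, atEvent T (window s fun _ => (1 : ℝ)) k ω * X k ω ^ 2‖ₑ) := by gcongr
    _ = upToEvent T n (s, ω) * ENNReal.ofReal (init ^ 2) +
      2 * ‖α * lam₀‖ₑ * (upToEvent T n (s, ω) *
        ∫⁻ r in Ioc (0 : ℝ) s, ENNReal.ofReal (lam r.toNNReal ω)) +
      2 * ‖α‖ₑ * (upToEvent T n (s, ω) *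
        ∫⁻ r in Ioc (0 : ℝ) s, ENNReal.ofReal (lam r.toNNReal ω ^ 2)) +
      2 * ‖β‖ₑ * (upToEvent T n (s, ω) *
        ‖∑' k, atEvent T (window s (leftIntensity α lam₀ β init T X lam)) k ω * X k ω‖ₑ) +
      ‖β‖ₑ ^ 2 * (upToEvent T n (s, ω) *
        ‖∑' k, atEvent T (window s fun _ => (1 : ℝ)) k ω * X k ω ^ 2‖ₑ) := by ring
    _ ≤ 1 * ENNReal.ofReal (init ^ 2) +
      2 * ‖α * lam₀‖ₑ * (∫⁻ r in Ioc (0 : ℝ) s, upToEvent T n (r.toNNReal, ω) *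
        ENNReal.ofReal (lam r.toNNReal ω)) +
      2 * ‖α‖ₑ * (∫⁻ r in Ioc (0 : ℝ) s, upToEvent T n (r.toNNReal, ω) *
        ENNReal.ofReal (lam r.toNNReal ω ^ 2)) +
      2 * ‖β‖ₑ * (∑' k, atEvent T (window s fun p => upToEvent T n p *
        ‖leftIntensity α lam₀ β init T X lam p‖ₑ) k ω * ‖X k ω‖ₑ) +
      ‖β‖ₑ ^ 2 * ∑' k, atEvent T (window s fun p => upToEvent T n p * ‖(1 : ℝ)‖ₑ) k ω *
        ‖X k ω ^ 2‖ₑ := by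
        gcongr
        · exact upToEvent_le_one _ _
        · exact upToEvent_mul_lintegral_le ω n s _
        · exact upToEvent_mul_lintegral_le ω n s _
        · exact upToEvent_mul_tsum_le ω n s _ _
        · exact upToEvent_mul_tsum_le ω n s _ (fun k => X k ω ^ 2)
    _ = _ := by rw [one_mul]

/-- The left limit at an event involves the integrated intensity and the jump sizes only to first
order. -/
theorem enorm_leftIntensity_atEvent_le {t : ℝ≥0} {k : ℕ} (hk : T k ω ≤ (t : WithTop ℝ≥0)) :
    ‖leftIntensity α lam₀ β init T X lam ((T k ω).untopD 0, ω)‖ₑ ≤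
      ENNReal.ofReal (|init| + |α * lam₀| * t) +
      ‖α‖ₑ * (∫⁻ r in Ioc (0 : ℝ) t, ENNReal.ofReal (lam r.toNNReal ω)) +
      ‖β‖ₑ * ∑' j, atEvent T (window t fun _ => ‖(1 : ℝ)‖ₑ) j ω * ‖X j ω‖ₑ := by
  obtain ⟨hk1, hk2⟩ := le_coe_iff.1 hk
  rw [leftIntensity, jumpsBefore_atEvent h.mono h.simple hk1]
  set r := (T k ω).untopD 0
  refine (enorm_add_le _ _).trans ?_
  rw [enorm_mul β]
  gcongr ?_ + _ * ?_
  · simp only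
    rw [show init + α * (lam₀ * r - integratedIntensity lam r ω) =
      (init + α * lam₀ * r) + (-α) * integratedIntensity lam r ω by ring]
    refine (enorm_add_le _ _).trans ?_
    rw [enorm_mul, enorm_neg]
    gcongr
    · rw [Real.enorm_eq_ofReal_abs]
      refine ENNReal.ofReal_le_ofReal ((abs_add_le _ _).trans ?_)
      rw [abs_mul _ (r : ℝ), abs_of_nonneg r.coe_nonneg]
      gcongr
    · exact (h.enorm_integratedIntensity_le r).trans
        (lintegral_mono_set (Ioc_subset_Ioc_right (NNReal.coe_le_coe.2 hk2)))
  · calc ‖∑ j ∈ Finset.range k, X j ω‖ₑ ≤ ∑ j ∈ Finset.range k, ‖X j ω‖ₑ := enorm_sum_le _ _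
      _ = ∑ j ∈ Finset.range k, atEvent T (window t fun _ => ‖(1 : ℝ)‖ₑ) j ω * ‖X j ω‖ₑ := by
          refine Finset.sum_congr rfl fun j hj => ?_
          have hj' := le_coe_iff.1 ((h.mono (Finset.mem_range.1 hj).le).trans hk)
          simp only [atEvent, window]
          rw [if_pos hj'.1, if_pos hj'.2, enorm_one, one_mul]
      _ ≤ _ := ENNReal.sum_le_tsum _

end IsGoodPath

section SecondMoment

variable [IsProbabilityMeasure P] [IsProbabilityMeasure ν]

omit [IsProbabilityMeasure ν] in
/-- The left limit of the intensity agrees with the intensity itself at almost all times. -/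
theorem lintegral_window_leftIntensity
    (hp : IsLinearSelfExciting P 𝓕 α lam₀ β init ν T X lam) (t : ℝ≥0) {f : ℝ≥0 × Ω → ℝ≥0∞}
    (hf : Measurable[𝓕.predictable] f) :
    ∫⁻ ω, (∫⁻ s in Ioi (0 : ℝ), window t (fun p => f p *
      ‖leftIntensity α lam₀ β init T X lam p‖ₑ) (s.toNNReal, ω) *
        ENNReal.ofReal (lam s.toNNReal ω)) ∂P =
      ∫⁻ s in Ioc (0 : ℝ) t, ∫⁻ ω, f (s.toNNReal, ω) *
        ENNReal.ofReal (lam s.toNNReal ω ^ 2) ∂P := by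
  simp only [lintegral_window_mul]
  have hsw := lintegral_lintegral_swap (μ := P) (ν := volume.restrict (Ioc (0 : ℝ) t))
    (f := fun ω s => f (s.toNNReal, ω) * ENNReal.ofReal (lam s.toNNReal ω ^ 2))
    ((measurable_comp_predictable hf).mul
      (hp.intensity.measurable_path.pow_const 2).ennreal_ofReal).aemeasurable
  rw [← hsw]
  refine lintegral_congr_ae ?_
  filter_upwards [hp.ae_isGoodPath] with ω hω
  refine lintegral_congr_ae ?_
  filter_upwards [ae_restrict_of_ae_restrict_of_subset Ioc_subset_Ioi_self
    hω.leftIntensity_ae_eq] with s hs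
  rw [hs, mul_assoc, Real.enorm_of_nonneg (hω.nonneg _), ← ENNReal.ofReal_mul (hω.nonneg _), sq]

/-- The localized integral of `λ²` is the expected sum of `λ(T_k-)` over the events up to `T_n`,
and each term is dominated by first moments. -/
theorem lintegral_window_upToEvent_sq_ne_top
    (hp : IsLinearSelfExciting P 𝓕 α lam₀ β init ν T X lam) (hν : Integrable (fun x : ℝ => x) ν)
    (t : ℝ≥0) (n : ℕ) :
    ∫⁻ s in Ioc (0 : ℝ) t, ∫⁻ ω, upToEvent T n (s.toNNReal, ω) *
      ENNReal.ofReal (lam s.toNNReal ω ^ 2) ∂P ≠ ∞ := by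
  obtain ⟨B, hB, hle⟩ := exists_lintegral_intensity_le hp hν t
  have hm := measurable_upToEvent hp.pointProcess n
  have hG := measurable_leftIntensity (α := α) (lam₀ := lam₀) (β := β) (init := init)
    hp.pointProcess hp.jumpLaw hp.intensity
  have hmG : Measurable[𝓕.predictable] fun p => upToEvent T n p *
      ‖leftIntensity α lam₀ β init T X lam p‖ₑ := hm.mul (measurable_enorm.comp hG)
  have hone : Measurable[𝓕.predictable] fun _ : ℝ≥0 × Ω => ‖(1 : ℝ)‖ₑ := measurable_const
  have hΛ : ∫⁻ s in Ioc (0 : ℝ) t, ∫⁻ ω, ENNReal.ofReal (lam s.toNNReal ω) ∂P ≠ ∞ := by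
    refine ne_top_of_le_ne_top (b := ∫⁻ _s in Ioc (0 : ℝ) t, B) ?_
      (setLIntegral_mono' measurableSet_Ioc fun s hs =>
        hle _ (Real.toNNReal_le_iff_le_coe.2 hs.2))
    rw [lintegral_const]
    exact ENNReal.mul_ne_top hB (by simp)
  have hjump := lintegral_tsum_atEvent_mul hp.pointProcess hp.jumpLaw hp.intensity
    (measurable_window t hone) (φ := fun x => ‖x‖ₑ) measurable_enorm
  rw [lintegral_lintegral_window_mul hp.intensity t hone] at hjump
  have hmi : Measurable fun ω => ∫⁻ r in Ioc (0 : ℝ) t, ENNReal.ofReal (lam r.toNNReal ω) :=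
    (hp.intensity.measurable_path.ennreal_ofReal).lintegral_prod_right'
  have hma : Measurable fun ω => ENNReal.ofReal (|init| + |α * lam₀| * t) +
      ‖α‖ₑ * (∫⁻ r in Ioc (0 : ℝ) t, ENNReal.ofReal (lam r.toNNReal ω)) :=
    measurable_const.add (hmi.const_mul _)
  rw [← lintegral_window_leftIntensity hp t hm,
    ← hp.intensity.lintegral_eq _ (measurable_window t hmG)]
  refine ne_top_of_le_ne_top (b := ∫⁻ ω, (n + 1) * (ENNReal.ofReal (|init| + |α * lam₀| * t) +
      ‖α‖ₑ * (∫⁻ r in Ioc (0 : ℝ) t, ENNReal.ofReal (lam r.toNNReal ω)) +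
      ‖β‖ₑ * ∑' j, atEvent T (window t fun _ => ‖(1 : ℝ)‖ₑ) j ω * ‖X j ω‖ₑ) ∂P) ?_ ?_
  · rw [lintegral_const_mul' _ _ (by finiteness), lintegral_add_left hma,
      lintegral_add_left measurable_const, lintegral_const_mul _ hmi,
      lintegral_const_mul' _ _ (by finiteness), hjump,
      lintegral_lintegral_swap hp.intensity.measurable_path.ennreal_ofReal.aemeasurable]
    simp only [enorm_one, one_mul, lintegral_const, measure_univ, mul_one]
    have := hν.2.ne
    finiteness
  · refine lintegral_mono_ae ?_
    filter_upwards [hp.ae_isGoodPath] with ω hω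
    exact hω.tsum_atEvent_upToEvent_mul_le n fun k hk => hω.enorm_leftIntensity_atEvent_le hk

theorem exists_lintegral_intensity_sq_le
    (hp : IsLinearSelfExciting P 𝓕 α lam₀ β init ν T X lam) (hν : Integrable (fun x : ℝ => x) ν)
    (hν2 : Integrable (fun x : ℝ => x ^ 2) ν) (t : ℝ≥0) :
    ∃ B : ℝ≥0∞, B ≠ ∞ ∧ ∀ s ≤ t, ∫⁻ ω, ENNReal.ofReal (lam s ω ^ 2) ∂P ≤ B := by
  have hlam : ∀ s, Measurable (lam s) := fun s => (hp.intensity.adapted s).mono (𝓕.le s) le_rfl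
  obtain ⟨B, hB, hle⟩ := exists_lintegral_intensity_le hp hν t
  set q : ℝ≥0 := (∫⁻ x, ‖x‖ₑ ∂ν).toNNReal with hq
  have hq' : ∫⁻ x, ‖x‖ₑ ∂ν = q := (ENNReal.coe_toNNReal hν.2.ne).symm
  have hq2 : ∫⁻ x, ‖x ^ 2‖ₑ ∂ν ≠ ∞ := hν2.2.ne
  refine ⟨_, ?_, fun s hs => lintegral_le_of_localized hp.pointProcess
    (Z := fun p => ENNReal.ofReal (lam p.1 p.2 ^ 2))
    (fun s => ((hlam s).pow_const 2).ennreal_ofReal)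
    (B := ENNReal.ofReal (init ^ 2) + 2 * ‖α * lam₀‖ₑ * (B * ENNReal.ofReal t) +
      ‖β‖ₑ ^ 2 * ((∫⁻ x, ‖x ^ 2‖ₑ ∂ν) * (B * ENNReal.ofReal t)))
    (by finiteness) (2 * ‖α‖₊ + 2 * ‖β‖₊ * q)
    (lintegral_window_upToEvent_sq_ne_top hp hν t) ?_ hs⟩
  · finiteness
  intro n s hs
  have hm := measurable_upToEvent hp.pointProcess n
  have hm1 : Measurable[𝓕.predictable] fun p => upToEvent T n p * ‖(1 : ℝ)‖ₑ := hm.mul_const _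
  have hG := measurable_leftIntensity (α := α) (lam₀ := lam₀) (β := β) (init := init)
    hp.pointProcess hp.jumpLaw hp.intensity
  have hmG : Measurable[𝓕.predictable] fun p => upToEvent T n p *
      ‖leftIntensity α lam₀ β init T X lam p‖ₑ := hm.mul (measurable_enorm.comp hG)
  have hΛ : ∫⁻ r in Ioc (0 : ℝ) s, ∫⁻ ω, upToEvent T n (r.toNNReal, ω) *
        ENNReal.ofReal (lam r.toNNReal ω) ∂P ≤ B * ENNReal.ofReal t := by
    calc _ ≤ ∫⁻ _r in Ioc (0 : ℝ) s, B := by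
          refine setLIntegral_mono' measurableSet_Ioc fun r hr => ?_
          refine le_trans (lintegral_mono fun ω => ?_)
            (hle r.toNNReal ((Real.toNNReal_le_iff_le_coe.2 hr.2).trans hs))
          exact mul_le_of_le_one_left' (upToEvent_le_one _ _)
      _ = B * ENNReal.ofReal s := by simp
      _ ≤ _ := by gcongr
  have hswap : ∫⁻ ω, (∫⁻ r in Ioc (0 : ℝ) s, upToEvent T n (r.toNNReal, ω) *
        ENNReal.ofReal (lam r.toNNReal ω)) ∂P =
      ∫⁻ r in Ioc (0 : ℝ) s, ∫⁻ ω, upToEvent T n (r.toNNReal, ω) *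
        ENNReal.ofReal (lam r.toNNReal ω) ∂P :=
    lintegral_lintegral_swap
      ((measurable_comp_predictable hm).mul
        hp.intensity.measurable_path.ennreal_ofReal).aemeasurable
  have hmsq : Measurable fun q : Ω × ℝ => upToEvent T n (q.2.toNNReal, q.1) *
      ENNReal.ofReal (lam q.2.toNNReal q.1 ^ 2) :=
    (measurable_comp_predictable hm).mul (hp.intensity.measurable_path.pow_const 2).ennreal_ofReal
  have hswap2 : ∫⁻ ω, (∫⁻ r in Ioc (0 : ℝ) s, upToEvent T n (r.toNNReal, ω) *
        ENNReal.ofReal (lam r.toNNReal ω ^ 2)) ∂P =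
      ∫⁻ r in Ioc (0 : ℝ) s, ∫⁻ ω, upToEvent T n (r.toNNReal, ω) *
        ENNReal.ofReal (lam r.toNNReal ω ^ 2) ∂P :=
    lintegral_lintegral_swap hmsq.aemeasurable
  have hjump1 := lintegral_tsum_atEvent_mul hp.pointProcess hp.jumpLaw hp.intensity
    (measurable_window s hmG) (φ := fun x => ‖x‖ₑ) measurable_enorm
  rw [lintegral_window_leftIntensity hp s hm, hq'] at hjump1
  have hjump2 := lintegral_tsum_atEvent_mul hp.pointProcess hp.jumpLaw hp.intensity
    (measurable_window s hm1) (φ := fun x => ‖x ^ 2‖ₑ) (by fun_prop)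
  rw [lintegral_lintegral_window_mul hp.intensity s hm1] at hjump2
  simp only [enorm_one, mul_one] at hjump2
  have hmi : Measurable fun ω => ∫⁻ r in Ioc (0 : ℝ) s, upToEvent T n (r.toNNReal, ω) *
        ENNReal.ofReal (lam r.toNNReal ω) :=
    ((measurable_comp_predictable hm).mul
      hp.intensity.measurable_path.ennreal_ofReal).lintegral_prod_right'
  have hmi2 : Measurable fun ω => ∫⁻ r in Ioc (0 : ℝ) s, upToEvent T n (r.toNNReal, ω) *
        ENNReal.ofReal (lam r.toNNReal ω ^ 2) := hmsq.lintegral_prod_right'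
  have hmj : Measurable fun ω => ∑' k, atEvent T (window s fun p => upToEvent T n p *
        ‖leftIntensity α lam₀ β init T X lam p‖ₑ) k ω * ‖X k ω‖ₑ :=
    Measurable.tsum fun k => (measurable_atEvent hp.pointProcess (measurable_window s hmG) k).mul
      (hp.jumpLaw.measurable k).enorm
  have hma : Measurable fun ω => ENNReal.ofReal (init ^ 2) +
      2 * ‖α * lam₀‖ₑ * (∫⁻ r in Ioc (0 : ℝ) s, upToEvent T n (r.toNNReal, ω) *
        ENNReal.ofReal (lam r.toNNReal ω)) := measurable_const.add (hmi.const_mul _)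
  have hma2 : Measurable fun ω => ENNReal.ofReal (init ^ 2) +
      2 * ‖α * lam₀‖ₑ * (∫⁻ r in Ioc (0 : ℝ) s, upToEvent T n (r.toNNReal, ω) *
        ENNReal.ofReal (lam r.toNNReal ω)) +
      2 * ‖α‖ₑ * (∫⁻ r in Ioc (0 : ℝ) s, upToEvent T n (r.toNNReal, ω) *
        ENNReal.ofReal (lam r.toNNReal ω ^ 2)) := hma.add (hmi2.const_mul _)
  have hma3 : Measurable fun ω => ENNReal.ofReal (init ^ 2) +
      2 * ‖α * lam₀‖ₑ * (∫⁻ r in Ioc (0 : ℝ) s, upToEvent T n (r.toNNReal, ω) *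
        ENNReal.ofReal (lam r.toNNReal ω)) +
      2 * ‖α‖ₑ * (∫⁻ r in Ioc (0 : ℝ) s, upToEvent T n (r.toNNReal, ω) *
        ENNReal.ofReal (lam r.toNNReal ω ^ 2)) +
      2 * ‖β‖ₑ * (∑' k, atEvent T (window s fun p => upToEvent T n p *
        ‖leftIntensity α lam₀ β init T X lam p‖ₑ) k ω * ‖X k ω‖ₑ) := hma2.add (hmj.const_mul _)
  calc _ ≤ ∫⁻ ω, (ENNReal.ofReal (init ^ 2) +
      2 * ‖α * lam₀‖ₑ * (∫⁻ r in Ioc (0 : ℝ) s, upToEvent T n (r.toNNReal, ω) *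
        ENNReal.ofReal (lam r.toNNReal ω)) +
      2 * ‖α‖ₑ * (∫⁻ r in Ioc (0 : ℝ) s, upToEvent T n (r.toNNReal, ω) *
        ENNReal.ofReal (lam r.toNNReal ω ^ 2)) +
      2 * ‖β‖ₑ * (∑' k, atEvent T (window s fun p => upToEvent T n p *
        ‖leftIntensity α lam₀ β init T X lam p‖ₑ) k ω * ‖X k ω‖ₑ) +
      ‖β‖ₑ ^ 2 * ∑' k, atEvent T (window s fun p => upToEvent T n p * ‖(1 : ℝ)‖ₑ) k ω *
        ‖X k ω ^ 2‖ₑ) ∂P := by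
        refine lintegral_mono_ae ?_
        filter_upwards [hp.ae_isGoodPath] with ω hω
        exact hω.upToEvent_mul_sq_le n s
    _ = ENNReal.ofReal (init ^ 2) +
      2 * ‖α * lam₀‖ₑ * (∫⁻ r in Ioc (0 : ℝ) s, ∫⁻ ω, upToEvent T n (r.toNNReal, ω) *
        ENNReal.ofReal (lam r.toNNReal ω) ∂P) +
      2 * ‖α‖ₑ * (∫⁻ r in Ioc (0 : ℝ) s, ∫⁻ ω, upToEvent T n (r.toNNReal, ω) *
        ENNReal.ofReal (lam r.toNNReal ω ^ 2) ∂P) +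
      2 * ‖β‖ₑ * (q * ∫⁻ r in Ioc (0 : ℝ) s, ∫⁻ ω, upToEvent T n (r.toNNReal, ω) *
        ENNReal.ofReal (lam r.toNNReal ω ^ 2) ∂P) +
      ‖β‖ₑ ^ 2 * ((∫⁻ x, ‖x ^ 2‖ₑ ∂ν) * ∫⁻ r in Ioc (0 : ℝ) s, ∫⁻ ω,
        upToEvent T n (r.toNNReal, ω) * ENNReal.ofReal (lam r.toNNReal ω) ∂P) := by
        rw [lintegral_add_left hma3, lintegral_add_left hma2, lintegral_add_left hma,
          lintegral_add_left measurable_const, lintegral_const_mul _ hmi,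
          lintegral_const_mul _ hmi2, lintegral_const_mul _ hmj,
          lintegral_const_mul' _ _ (by finiteness), hswap, hswap2, hjump1]
        simp only [enorm_one, mul_one]
        rw [hjump2, lintegral_const, measure_univ, mul_one]
    _ ≤ ENNReal.ofReal (init ^ 2) +
      2 * ‖α * lam₀‖ₑ * (B * ENNReal.ofReal t) +
      2 * ‖α‖ₑ * (∫⁻ r in Ioc (0 : ℝ) s, ∫⁻ ω, upToEvent T n (r.toNNReal, ω) *
        ENNReal.ofReal (lam r.toNNReal ω ^ 2) ∂P) +
      2 * ‖β‖ₑ * (q * ∫⁻ r in Ioc (0 : ℝ) s, ∫⁻ ω, upToEvent T n (r.toNNReal, ω) *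
        ENNReal.ofReal (lam r.toNNReal ω ^ 2) ∂P) +
      ‖β‖ₑ ^ 2 * ((∫⁻ x, ‖x ^ 2‖ₑ ∂ν) * (B * ENNReal.ofReal t)) := by gcongr
    _ = _ := by
        push_cast
        simp only [enorm_eq_nnnorm]
        ring

end SecondMoment

/-! ### Integral equations for the moments -/

section Fubini

variable [IsFiniteMeasure P] {F : Ω × ℝ → ℝ} {t : ℝ≥0}

theorem integrable_prod_Ioc_of_lintegral_le (hF : Measurable F) {B : ℝ≥0∞} (hB : B ≠ ∞)
    (h : ∀ s : ℝ≥0, s ≤ t → ∫⁻ ω, ‖F (ω, s)‖ₑ ∂P ≤ B) :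
    Integrable F (P.prod (volume.restrict (Ioc (0 : ℝ) t))) := by
  refine ⟨hF.aestronglyMeasurable, ?_⟩
  rw [HasFiniteIntegral, lintegral_prod_symm _ hF.enorm.aemeasurable]
  calc _ ≤ ∫⁻ _s in Ioc (0 : ℝ) t, B := by
        refine setLIntegral_mono' measurableSet_Ioc fun s hs => ?_
        lift s to ℝ≥0 using hs.1.le
        exact h s (NNReal.coe_le_coe.1 hs.2)
    _ < ∞ := by simpa using ENNReal.mul_lt_top hB.lt_top ENNReal.coe_lt_top

variable (hF : Integrable F (P.prod (volume.restrict (Ioc (0 : ℝ) t))))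
include hF

theorem integral_intervalIntegral_swap :
    ∫ ω, (∫ s in (0 : ℝ)..t, F (ω, s)) ∂P = ∫ s in (0 : ℝ)..t, ∫ ω, F (ω, s) ∂P := by
  simp only [intervalIntegral.integral_of_le t.coe_nonneg]
  exact integral_integral_swap (f := fun ω s => F (ω, s)) hF

omit [IsFiniteMeasure P] in
theorem integrable_intervalIntegral : Integrable (fun ω => ∫ s in (0 : ℝ)..t, F (ω, s)) P := by
  simp only [intervalIntegral.integral_of_le t.coe_nonneg]
  exact hF.integral_prod_left

theorem intervalIntegrable_integral :
    IntervalIntegrable (fun s => ∫ ω, F (ω, s) ∂P) volume 0 t :=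
  (intervalIntegrable_iff_integrableOn_Ioc_of_le t.coe_nonneg).2 hF.integral_prod_right

end Fubini

theorem integral_window_mul (t : ℝ≥0) (f : ℝ≥0 × Ω → ℝ) (g : ℝ → ℝ) (ω : Ω) :
    ∫ s in Ioi (0 : ℝ), window t f (s.toNNReal, ω) * g s =
      ∫ s in (0 : ℝ)..t, f (s.toNNReal, ω) * g s := by
  rw [intervalIntegral.integral_of_le t.coe_nonneg, ← integral_indicator measurableSet_Ioi,
    ← integral_indicator measurableSet_Ioc]
  congr 1
  ext s
  by_cases h0 : 0 < s
  · by_cases ht : s ≤ t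
    · simp [h0, ht, window, Real.toNNReal_le_iff_le_coe]
    · simp [h0, ht, window, Real.toNNReal_le_iff_le_coe]
  · simp [h0]

/-- The compensation formula on the time interval `[0, t]`. -/
theorem integral_tsum_atEvent_window_mul [IsFiniteMeasure P] [IsProbabilityMeasure ν]
    (hT : IsPointProcess P 𝓕 T) (hX : HasJumpLaw P 𝓕 T X ν)
    (hI : IsIntensity P 𝓕 T lam) {f : ℝ≥0 × Ω → ℝ} (hf : Measurable[𝓕.predictable] f) {t : ℝ≥0}
    (hfin : ∫⁻ s in Ioc (0 : ℝ) t, ∫⁻ ω, ‖f (s.toNNReal, ω)‖ₑ *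
      ENNReal.ofReal (lam s.toNNReal ω) ∂P ≠ ∞) {φ : ℝ → ℝ} (hφ : Measurable φ)
    (hφν : Integrable φ ν) :
    Integrable (fun ω => ∑' n, atEvent T (window t f) n ω * φ (X n ω)) P ∧
    ∫ ω, ∑' n, atEvent T (window t f) n ω * φ (X n ω) ∂P = (∫ x, φ x ∂ν) *
      ∫ ω, (∫ s in (0 : ℝ)..t, f (s.toNNReal, ω) * lam s.toNNReal ω) ∂P := by
  have hw : ∀ p, ‖window t f p‖ₑ = window t (fun p => ‖f p‖ₑ) p := by
    intro p
    unfold window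
    split_ifs <;> simp
  have key := integral_tsum_atEvent_mul hT hX hI (measurable_window t hf) (φ := φ)
    (by
      simp only [hw]
      rwa [lintegral_lintegral_window_mul hI t (f := fun p => ‖f p‖ₑ)
        (measurable_enorm.comp hf)]) hφ hφν
  simpa only [integral_window_mul] using key

/-- Jensen's inequality for the time average of the intensity. -/
theorem IsGoodPath.integratedIntensity_sq_le {ω : Ω}
    (h : IsGoodPath T X lam α lam₀ β init ω) (t : ℝ≥0) :
    integratedIntensity lam t ω ^ 2 ≤ t * ∫ s in (0 : ℝ)..t, lam s.toNNReal ω ^ 2 := by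
  rcases eq_or_ne t 0 with rfl | ht
  · simp [integratedIntensity]
  have ht' : (0 : ℝ) < t := NNReal.coe_pos.2 (pos_iff_ne_zero.2 ht)
  -- the integral of the squared deviation from the mean `Λ(t) / t` is nonnegative
  set c := integratedIntensity lam t ω / t with hc
  have h0 : 0 ≤ ∫ s in (0 : ℝ)..t, (lam s.toNNReal ω - c) ^ 2 :=
    intervalIntegral.integral_nonneg t.coe_nonneg fun _ _ => sq_nonneg _
  have hsq : IntervalIntegrable (fun s : ℝ => lam s.toNNReal ω ^ 2) volume 0 t := by
    simpa only [sq] using (h.cadlag.mul h.cadlag).intervalIntegrable 0 t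
  have hexp : ∫ s in (0 : ℝ)..t, (lam s.toNNReal ω - c) ^ 2 =
      (∫ s in (0 : ℝ)..t, lam s.toNNReal ω ^ 2) - 2 * c * integratedIntensity lam t ω +
        t * c ^ 2 := by
    have e : ∀ s : ℝ, (lam s.toNNReal ω - c) ^ 2 =
        lam s.toNNReal ω ^ 2 - 2 * c * lam s.toNNReal ω + c ^ 2 := fun s => by ring
    simp only [e]
    rw [intervalIntegral.integral_add (hsq.sub ((h.cadlag.intervalIntegrable 0 t).const_mul _))
      intervalIntegrable_const, intervalIntegral.integral_sub hsq
      ((h.cadlag.intervalIntegrable 0 t).const_mul _), intervalIntegral.integral_const_mul,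
      intervalIntegral.integral_const]
    simp [integratedIntensity]
  have hct : integratedIntensity lam t ω = c * t := by rw [hc]; field_simp
  rw [hexp, hct] at h0
  rw [hct]
  nlinarith

theorem IsGoodPath.integratedIntensity_mono {ω : Ω}
    (h : IsGoodPath T X lam α lam₀ β init ω) {s t : ℝ≥0} (hst : s ≤ t) :
    integratedIntensity lam s ω ≤ integratedIntensity lam t ω :=
  intervalIntegral.integral_mono_interval le_rfl s.coe_nonneg (NNReal.coe_le_coe.2 hst)
    (Eventually.of_forall fun _ => h.nonneg _) (h.cadlag.intervalIntegrable 0 t)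

namespace IsLinearSelfExciting

variable [IsProbabilityMeasure P] [IsProbabilityMeasure ν]
  (hp : IsLinearSelfExciting P 𝓕 α lam₀ β init ν T X lam)
include hp

section First

variable (hν : Integrable (fun x : ℝ => x) ν)
include hν

theorem exists_lintegral_enorm_le (t : ℝ≥0) :
    ∃ B : ℝ≥0∞, B ≠ ∞ ∧ ∀ s ≤ t, ∫⁻ ω, ‖lam s ω‖ₑ ∂P ≤ B := by
  obtain ⟨B, hB, h⟩ := exists_lintegral_intensity_le hp hν t
  refine ⟨B, hB, fun s hs => le_trans (le_of_eq (lintegral_congr_ae ?_)) (h s hs)⟩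
  filter_upwards [hp.intensity.nonneg] with ω hω
  exact Real.enorm_of_nonneg (hω s)

theorem integrable_intensity (t : ℝ≥0) : Integrable (lam t) P := by
  obtain ⟨B, hB, h⟩ := hp.exists_lintegral_enorm_le hν t
  exact ⟨((hp.intensity.adapted t).mono (𝓕.le t) le_rfl).aestronglyMeasurable,
    (h t le_rfl).trans_lt hB.lt_top⟩

theorem integrable_prod_intensity (t : ℝ≥0) : Integrable (fun q : Ω × ℝ => lam q.2.toNNReal q.1)
    (P.prod (volume.restrict (Ioc (0 : ℝ) t))) := by
  obtain ⟨B, hB, h⟩ := hp.exists_lintegral_enorm_le hν t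
  exact integrable_prod_Ioc_of_lintegral_le hp.intensity.measurable_path hB
    (fun s hs => by simpa using h s hs)

theorem integrable_integratedIntensity (t : ℝ≥0) : Integrable (integratedIntensity lam t) P :=
  integrable_intervalIntegral (hp.integrable_prod_intensity hν t)

theorem integral_integratedIntensity (t : ℝ≥0) :
    ∫ ω, integratedIntensity lam t ω ∂P = ∫ s in (0 : ℝ)..t, ∫ ω, lam s.toNNReal ω ∂P :=
  integral_intervalIntegral_swap (hp.integrable_prod_intensity hν t)

theorem lintegral_one_mul_ne_top (t : ℝ≥0) :
    ∫⁻ s in Ioc (0 : ℝ) t, ∫⁻ ω, ‖(1 : ℝ)‖ₑ * ENNReal.ofReal (lam s.toNNReal ω) ∂P ≠ ∞ := by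
  obtain ⟨B, hB, h⟩ := exists_lintegral_intensity_le hp hν t
  refine ne_top_of_le_ne_top (b := ∫⁻ _s in Ioc (0 : ℝ) t, B) ?_
    (setLIntegral_mono' measurableSet_Ioc fun s hs => ?_)
  · rw [lintegral_const]
    exact ENNReal.mul_ne_top hB (by simp)
  · simpa using h _ (Real.toNNReal_le_iff_le_coe.2 hs.2)

theorem integral_tsum_jump {φ : ℝ → ℝ} (hφ : Measurable φ) (hφν : Integrable φ ν) (t : ℝ≥0) :
    Integrable (fun ω => ∑' n, atEvent T (window t fun _ => 1) n ω * φ (X n ω)) P ∧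
    ∫ ω, ∑' n, atEvent T (window t fun _ => 1) n ω * φ (X n ω) ∂P = (∫ x, φ x ∂ν) *
      ∫ s in (0 : ℝ)..t, ∫ ω, lam s.toNNReal ω ∂P := by
  have h := integral_tsum_atEvent_window_mul hp.pointProcess hp.jumpLaw hp.intensity
    (f := fun _ => 1) measurable_const (hp.lintegral_one_mul_ne_top hν t) hφ hφν
  simp only [one_mul] at h
  rwa [integral_intervalIntegral_swap (hp.integrable_prod_intensity hν t)] at h

/-- The mean of the intensity solves a linear integral equation. -/
theorem integral_intensity_eq (t : ℝ≥0) :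
    ∫ ω, lam t ω ∂P = init + ∫ s in (0 : ℝ)..t,
      (α * lam₀ + (β * (∫ x, x ∂ν) - α) * ∫ ω, lam s.toNNReal ω ∂P) := by
  obtain ⟨hj, hj'⟩ := hp.integral_tsum_jump hν measurable_id hν t
  simp only [id] at hj hj'
  have hΛ := hp.integrable_integratedIntensity hν t
  have hm := intervalIntegrable_integral (hp.integrable_prod_intensity hν t)
  calc ∫ ω, lam t ω ∂P = ∫ ω, (init + α * (lam₀ * t - integratedIntensity lam t ω) +
        β * ∑' n, atEvent T (window t fun _ => 1) n ω * X n ω) ∂P := by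
        refine integral_congr_ae ?_
        filter_upwards [hp.ae_isGoodPath] with ω hω
        exact hω.eq_init_add t
    _ = init + α * (lam₀ * t - ∫ s in (0 : ℝ)..t, ∫ ω, lam s.toNNReal ω ∂P) +
        β * ((∫ x, x ∂ν) * ∫ s in (0 : ℝ)..t, ∫ ω, lam s.toNNReal ω ∂P) := by
        rw [integral_add _ (hj.const_mul β), integral_add (integrable_const _),
          integral_const_mul, integral_const_mul, integral_sub (integrable_const _) hΛ, hj',
          hp.integral_integratedIntensity hν]
        · simp
        · exact ((integrable_const _).sub hΛ).const_mul α
        · exact (integrable_const _).add (((integrable_const _).sub hΛ).const_mul α)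
    _ = _ := by
        rw [intervalIntegral.integral_add intervalIntegrable_const (hm.const_mul _),
          intervalIntegral.integral_const]
        simp only [intervalIntegral.integral_const_mul, sub_zero, smul_eq_mul]
        ring

end First

section Second

variable (hν : Integrable (fun x : ℝ => x) ν) (hν2 : Integrable (fun x : ℝ => x ^ 2) ν)
include hν hν2

theorem exists_lintegral_enorm_sq_le (t : ℝ≥0) :
    ∃ B : ℝ≥0∞, B ≠ ∞ ∧ ∀ s ≤ t, ∫⁻ ω, ‖lam s ω ^ 2‖ₑ ∂P ≤ B := by
  obtain ⟨B, hB, h⟩ := exists_lintegral_intensity_sq_le hp hν hν2 t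
  refine ⟨B, hB, fun s hs => le_trans (le_of_eq (lintegral_congr fun ω => ?_)) (h s hs)⟩
  exact Real.enorm_of_nonneg (sq_nonneg _)

theorem integrable_intensity_sq (t : ℝ≥0) : Integrable (fun ω => lam t ω ^ 2) P := by
  obtain ⟨B, hB, h⟩ := hp.exists_lintegral_enorm_sq_le hν hν2 t
  exact ⟨(((hp.intensity.adapted t).mono (𝓕.le t) le_rfl).pow_const 2).aestronglyMeasurable,
    (h t le_rfl).trans_lt hB.lt_top⟩

theorem integrable_prod_intensity_sq (t : ℝ≥0) :
    Integrable (fun q : Ω × ℝ => lam q.2.toNNReal q.1 ^ 2)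
      (P.prod (volume.restrict (Ioc (0 : ℝ) t))) := by
  obtain ⟨B, hB, h⟩ := hp.exists_lintegral_enorm_sq_le hν hν2 t
  exact integrable_prod_Ioc_of_lintegral_le (hp.intensity.measurable_path.pow_const 2) hB
    (fun s hs => by simpa using h s hs)

theorem integral_tsum_leftIntensity (t : ℝ≥0) :
    Integrable (fun ω => ∑' n, atEvent T (window t (leftIntensity α lam₀ β init T X lam)) n ω *
      X n ω) P ∧
    ∫ ω, ∑' n, atEvent T (window t (leftIntensity α lam₀ β init T X lam)) n ω * X n ω ∂P =
      (∫ x, x ∂ν) * ∫ s in (0 : ℝ)..t, ∫ ω, lam s.toNNReal ω ^ 2 ∂P := by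
  have hG := measurable_leftIntensity (α := α) (lam₀ := lam₀) (β := β) (init := init)
    hp.pointProcess hp.jumpLaw hp.intensity
  have hone : Measurable[𝓕.predictable] fun _ : ℝ≥0 × Ω => (1 : ℝ≥0∞) := measurable_const
  have hGe : Measurable[𝓕.predictable] fun p => ‖leftIntensity α lam₀ β init T X lam p‖ₑ :=
    measurable_enorm.comp hG
  have hfin : ∫⁻ s in Ioc (0 : ℝ) t, ∫⁻ ω, ‖leftIntensity α lam₀ β init T X lam
      (s.toNNReal, ω)‖ₑ * ENNReal.ofReal (lam s.toNNReal ω) ∂P ≠ ∞ := by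
    rw [← lintegral_lintegral_window_mul hp.intensity t hGe]
    have h1 := lintegral_window_leftIntensity hp t hone
    simp only [one_mul] at h1
    rw [h1]
    obtain ⟨B, hB, h⟩ := exists_lintegral_intensity_sq_le hp hν hν2 t
    refine ne_top_of_le_ne_top (b := ∫⁻ _s in Ioc (0 : ℝ) t, B) ?_
      (setLIntegral_mono' measurableSet_Ioc fun s hs => h _ (Real.toNNReal_le_iff_le_coe.2 hs.2))
    rw [lintegral_const]
    exact ENNReal.mul_ne_top hB (by simp)
  have key := integral_tsum_atEvent_window_mul hp.pointProcess hp.jumpLaw hp.intensity hG hfin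
    measurable_id hν
  refine ⟨key.1, key.2.trans ?_⟩
  simp only [id]
  rw [← integral_intervalIntegral_swap (hp.integrable_prod_intensity_sq hν hν2 t)]
  congr 1
  refine integral_congr_ae ?_
  filter_upwards [hp.ae_isGoodPath] with ω hω
  refine intervalIntegral.integral_congr_ae_restrict ?_
  rw [uIoc_of_le t.coe_nonneg]
  filter_upwards [ae_restrict_of_ae_restrict_of_subset Ioc_subset_Ioi_self
    hω.leftIntensity_ae_eq] with s hs
  rw [hs, sq]

/-- The second moment of the intensity solves a linear integral equation driven by the mean. -/
theorem integral_intensity_sq_eq (t : ℝ≥0) :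
    ∫ ω, lam t ω ^ 2 ∂P = init ^ 2 + ∫ s in (0 : ℝ)..t,
      ((2 * α * lam₀ + β ^ 2 * ∫ x, x ^ 2 ∂ν) * (∫ ω, lam s.toNNReal ω ∂P) +
        2 * (β * (∫ x, x ∂ν) - α) * ∫ ω, lam s.toNNReal ω ^ 2 ∂P) := by
  obtain ⟨hj, hj'⟩ := hp.integral_tsum_jump hν (φ := fun x => x ^ 2) (by fun_prop) hν2 t
  obtain ⟨hG, hG'⟩ := hp.integral_tsum_leftIntensity hν hν2 t
  have h1 := hp.integrable_prod_intensity hν t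
  have h2 := hp.integrable_prod_intensity_sq hν hν2 t
  have hd : Integrable (fun q : Ω × ℝ => lam q.2.toNNReal q.1 * (α * (lam₀ - lam q.2.toNNReal q.1)))
      (P.prod (volume.restrict (Ioc (0 : ℝ) t))) := by
    refine ((h1.const_mul (α * lam₀)).sub (h2.const_mul α)).congr
      (Eventually.of_forall fun q => ?_)
    simp only [Pi.sub_apply]
    ring
  have hdI := integrable_intervalIntegral hd
  have hdE : ∀ s : ℝ, ∫ ω, lam s.toNNReal ω * (α * (lam₀ - lam s.toNNReal ω)) ∂P =
      α * lam₀ * (∫ ω, lam s.toNNReal ω ∂P) - α * ∫ ω, lam s.toNNReal ω ^ 2 ∂P := by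
    intro s
    rw [← integral_const_mul, ← integral_const_mul, ← integral_sub
      ((hp.integrable_intensity hν _).const_mul _)
      ((hp.integrable_intensity_sq hν hν2 _).const_mul _)]
    congr 1
    ext ω
    ring
  have hm := intervalIntegrable_integral h1
  have hw := intervalIntegrable_integral h2
  calc ∫ ω, lam t ω ^ 2 ∂P = ∫ ω, (init ^ 2 +
      2 * (∫ s in (0 : ℝ)..t, lam s.toNNReal ω * (α * (lam₀ - lam s.toNNReal ω))) +
      2 * β * (∑' n, atEvent T (window t (leftIntensity α lam₀ β init T X lam)) n ω * X n ω) +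
      β ^ 2 * ∑' n, atEvent T (window t fun _ => 1) n ω * X n ω ^ 2) ∂P := by
        refine integral_congr_ae ?_
        filter_upwards [hp.ae_isGoodPath] with ω hω
        exact hω.sq_eq t
    _ = init ^ 2 + 2 * (∫ s in (0 : ℝ)..t, (α * lam₀ * (∫ ω, lam s.toNNReal ω ∂P) -
          α * ∫ ω, lam s.toNNReal ω ^ 2 ∂P)) +
        2 * β * ((∫ x, x ∂ν) * ∫ s in (0 : ℝ)..t, ∫ ω, lam s.toNNReal ω ^ 2 ∂P) +
        β ^ 2 * ((∫ x, x ^ 2 ∂ν) * ∫ s in (0 : ℝ)..t, ∫ ω, lam s.toNNReal ω ∂P) := by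
        have i0 : Integrable (fun _ : Ω => init ^ 2) P := integrable_const _
        have i1 := i0.add (hdI.const_mul 2)
        have i2 := i1.add (hG.const_mul (2 * β))
        have e1 := integral_add i2 (hj.const_mul (β ^ 2))
        have e2 := integral_add i1 (hG.const_mul (2 * β))
        have e3 := integral_add i0 (hdI.const_mul 2)
        simp only [Pi.add_apply] at e1 e2 e3
        rw [e1, e2, e3, integral_const_mul, integral_const_mul, integral_const_mul, hj', hG',
          integral_intervalIntegral_swap hd]
        simp only [hdE]
        simp
    _ = _ := by
        rw [intervalIntegral.integral_add (hm.const_mul _) (hw.const_mul _),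
          intervalIntegral.integral_sub (hm.const_mul _) (hw.const_mul _)]
        simp only [intervalIntegral.integral_const_mul]
        ring

theorem integrable_integratedIntensity_sq (t : ℝ≥0) :
    Integrable (fun ω => integratedIntensity lam t ω ^ 2) P := by
  refine Integrable.mono' ((integrable_intervalIntegral
    (hp.integrable_prod_intensity_sq hν hν2 t)).const_mul (t : ℝ))
    ((hp.integrable_integratedIntensity hν t).aestronglyMeasurable.pow 2) ?_
  filter_upwards [hp.ae_isGoodPath] with ω hω
  rw [Real.norm_of_nonneg (sq_nonneg _)]
  exact hω.integratedIntensity_sq_le t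

theorem exists_lintegral_enorm_mul_le (t : ℝ≥0) :
    ∃ B : ℝ≥0∞, B ≠ ∞ ∧ ∀ s ≤ t, ∫⁻ ω, ‖integratedIntensity lam s ω * lam s ω‖ₑ ∂P ≤ B := by
  obtain ⟨B, hB, h⟩ := hp.exists_lintegral_enorm_sq_le hν hν2 t
  have hΛ := hp.integrable_integratedIntensity_sq hν hν2 t
  refine ⟨∫⁻ ω, ‖integratedIntensity lam t ω ^ 2‖ₑ ∂P + B, ENNReal.add_ne_top.2 ⟨hΛ.2.ne, hB⟩,
    fun s hs => ?_⟩
  refine le_trans ?_ (add_le_add_right (h s hs) _)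
  rw [← lintegral_add_left' hΛ.1.enorm]
  refine lintegral_mono_ae ?_
  filter_upwards [hp.ae_isGoodPath] with ω hω
  have h1 := hω.integratedIntensity_nonneg s
  have h2 := hω.nonneg s
  have h3 := hω.integratedIntensity_mono hs
  rw [Real.enorm_of_nonneg (mul_nonneg h1 h2), Real.enorm_of_nonneg (sq_nonneg _),
    Real.enorm_of_nonneg (sq_nonneg _), ← ENNReal.ofReal_add (sq_nonneg _) (sq_nonneg _)]
  refine ENNReal.ofReal_le_ofReal ?_
  nlinarith [sq_nonneg (integratedIntensity lam s ω - lam s ω), pow_le_pow_left₀ h1 h3 2,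
    sq_nonneg (lam s ω)]

omit [IsProbabilityMeasure P] [IsProbabilityMeasure ν] hν hν2 in
theorem measurable_integratedIntensity_path :
    Measurable fun q : Ω × ℝ => integratedIntensity lam q.2.toNNReal q.1 :=
  measurable_comp_predictable (measurable_integral_predictable hp.intensity.adapted
    hp.intensity.rightContinuous)

theorem integrable_integratedIntensity_mul (t : ℝ≥0) :
    Integrable (fun ω => integratedIntensity lam t ω * lam t ω) P := by
  obtain ⟨B, hB, h⟩ := hp.exists_lintegral_enorm_mul_le hν hν2 t
  exact ⟨(hp.integrable_integratedIntensity hν t).1.mul (hp.integrable_intensity hν t).1,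
    (h t le_rfl).trans_lt hB.lt_top⟩

theorem integrable_prod_integratedIntensity_mul (t : ℝ≥0) :
    Integrable (fun q : Ω × ℝ => integratedIntensity lam q.2.toNNReal q.1 * lam q.2.toNNReal q.1)
      (P.prod (volume.restrict (Ioc (0 : ℝ) t))) := by
  obtain ⟨B, hB, h⟩ := hp.exists_lintegral_enorm_mul_le hν hν2 t
  exact integrable_prod_Ioc_of_lintegral_le
    (hp.measurable_integratedIntensity_path.mul hp.intensity.measurable_path) hB
    (fun s hs => by simpa using h s hs)

omit hν2 in
theorem integrable_prod_integratedIntensity (t : ℝ≥0) :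
    Integrable (fun q : Ω × ℝ => integratedIntensity lam q.2.toNNReal q.1)
      (P.prod (volume.restrict (Ioc (0 : ℝ) t))) := by
  refine integrable_prod_Ioc_of_lintegral_le hp.measurable_integratedIntensity_path
    (hp.integrable_integratedIntensity hν t).2.ne fun s hs => lintegral_mono_ae ?_
  filter_upwards [hp.ae_isGoodPath] with ω hω
  rw [Real.toNNReal_coe, Real.enorm_of_nonneg (hω.integratedIntensity_nonneg s),
    Real.enorm_of_nonneg (hω.integratedIntensity_nonneg t)]
  exact ENNReal.ofReal_le_ofReal (hω.integratedIntensity_mono hs)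

theorem integral_tsum_integratedIntensity (t : ℝ≥0) :
    Integrable (fun ω => ∑' n, atEvent T (window t fun p => integratedIntensity lam p.1 p.2) n ω *
      X n ω) P ∧
    ∫ ω, ∑' n, atEvent T (window t fun p => integratedIntensity lam p.1 p.2) n ω * X n ω ∂P =
      (∫ x, x ∂ν) * ∫ s in (0 : ℝ)..t,
        ∫ ω, integratedIntensity lam s.toNNReal ω * lam s.toNNReal ω ∂P := by
  have hfin : ∫⁻ s in Ioc (0 : ℝ) t, ∫⁻ ω, ‖integratedIntensity lam s.toNNReal ω‖ₑ *
      ENNReal.ofReal (lam s.toNNReal ω) ∂P ≠ ∞ := by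
    obtain ⟨B, hB, h⟩ := hp.exists_lintegral_enorm_mul_le hν hν2 t
    refine ne_top_of_le_ne_top (b := ∫⁻ _s in Ioc (0 : ℝ) t, B) ?_
      (setLIntegral_mono' measurableSet_Ioc fun s hs => le_trans (le_of_eq (lintegral_congr_ae ?_))
        (h _ (Real.toNNReal_le_iff_le_coe.2 hs.2)))
    · rw [lintegral_const]
      exact ENNReal.mul_ne_top hB (by simp)
    · filter_upwards [hp.ae_isGoodPath] with ω hω
      rw [enorm_mul, Real.enorm_of_nonneg (hω.nonneg _)]
  have key := integral_tsum_atEvent_window_mul hp.pointProcess hp.jumpLaw hp.intensity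
    (measurable_integral_predictable hp.intensity.adapted hp.intensity.rightContinuous) hfin
    measurable_id hν
  rw [integral_intervalIntegral_swap (hp.integrable_prod_integratedIntensity_mul hν hν2 t)] at key
  exact key

/-- The mixed moment `E[Λ λ]` solves a linear integral equation driven by the moments of `λ`. -/
theorem integral_integratedIntensity_mul_eq (t : ℝ≥0) :
    ∫ ω, integratedIntensity lam t ω * lam t ω ∂P = ∫ s in (0 : ℝ)..t,
      ((∫ ω, lam s.toNNReal ω ^ 2 ∂P) +
        α * lam₀ * (∫ ω, integratedIntensity lam s.toNNReal ω ∂P) +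
        (β * (∫ x, x ∂ν) - α) *
          ∫ ω, integratedIntensity lam s.toNNReal ω * lam s.toNNReal ω ∂P) := by
  obtain ⟨hj, hj'⟩ := hp.integral_tsum_integratedIntensity hν hν2 t
  have h2 := hp.integrable_prod_intensity_sq hν hν2 t
  have h3 := hp.integrable_prod_integratedIntensity hν t
  have h4 := hp.integrable_prod_integratedIntensity_mul hν hν2 t
  have hd : Integrable (fun q : Ω × ℝ => lam q.2.toNNReal q.1 ^ 2 +
      integratedIntensity lam q.2.toNNReal q.1 * (α * (lam₀ - lam q.2.toNNReal q.1)))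
      (P.prod (volume.restrict (Ioc (0 : ℝ) t))) := by
    refine (h2.add ((h3.const_mul (α * lam₀)).sub (h4.const_mul α))).congr
      (Eventually.of_forall fun q => ?_)
    simp only [Pi.sub_apply, Pi.add_apply]
    ring
  have hdI := integrable_intervalIntegral hd
  have hdE : ∀ s : ℝ, ∫ ω, (lam s.toNNReal ω ^ 2 +
      integratedIntensity lam s.toNNReal ω * (α * (lam₀ - lam s.toNNReal ω))) ∂P =
      (∫ ω, lam s.toNNReal ω ^ 2 ∂P) +
        (α * lam₀ * (∫ ω, integratedIntensity lam s.toNNReal ω ∂P) -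
        α * ∫ ω, integratedIntensity lam s.toNNReal ω * lam s.toNNReal ω ∂P) := by
    intro s
    have i1 := (hp.integrable_integratedIntensity hν s.toNNReal).const_mul (α * lam₀)
    have i2 := (hp.integrable_integratedIntensity_mul hν hν2 s.toNNReal).const_mul α
    have i3 : Integrable (fun ω => α * lam₀ * integratedIntensity lam s.toNNReal ω -
      α * (integratedIntensity lam s.toNNReal ω * lam s.toNNReal ω)) P := i1.sub i2
    rw [← integral_const_mul, ← integral_const_mul, ← integral_sub i1 i2,
      ← integral_add (hp.integrable_intensity_sq hν hν2 _) i3]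
    congr 1
    ext ω
    ring
  have hw := intervalIntegrable_integral h2
  have ha := intervalIntegrable_integral h3
  have hm := intervalIntegrable_integral h4
  calc ∫ ω, integratedIntensity lam t ω * lam t ω ∂P =
      ∫ ω, ((∫ s in (0 : ℝ)..t, (lam s.toNNReal ω ^ 2 +
        integratedIntensity lam s.toNNReal ω * (α * (lam₀ - lam s.toNNReal ω)))) +
      β * ∑' n, atEvent T (window t fun p => integratedIntensity lam p.1 p.2) n ω * X n ω) ∂P := by
        refine integral_congr_ae ?_
        filter_upwards [hp.ae_isGoodPath] with ω hω
        exact hω.integratedIntensity_mul_eq t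
    _ = (∫ s in (0 : ℝ)..t, ((∫ ω, lam s.toNNReal ω ^ 2 ∂P) +
        (α * lam₀ * (∫ ω, integratedIntensity lam s.toNNReal ω ∂P) -
        α * ∫ ω, integratedIntensity lam s.toNNReal ω * lam s.toNNReal ω ∂P))) +
        β * ((∫ x, x ∂ν) * ∫ s in (0 : ℝ)..t,
          ∫ ω, integratedIntensity lam s.toNNReal ω * lam s.toNNReal ω ∂P) := by
        rw [integral_add hdI (hj.const_mul β), integral_const_mul, hj',
          integral_intervalIntegral_swap hd]
        simp only [hdE]
    _ = _ := by
        rw [intervalIntegral.integral_add hw ((ha.const_mul _).sub (hm.const_mul _)),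
          intervalIntegral.integral_sub (ha.const_mul _) (hm.const_mul _),
          intervalIntegral.integral_add (hw.add (ha.const_mul _)) (hm.const_mul _),
          intervalIntegral.integral_add hw (ha.const_mul _)]
        simp only [intervalIntegral.integral_const_mul]
        ring

theorem integral_integratedIntensity_sq_eq (t : ℝ≥0) :
    ∫ ω, integratedIntensity lam t ω ^ 2 ∂P = 2 * ∫ s in (0 : ℝ)..t,
      ∫ ω, integratedIntensity lam s.toNNReal ω * lam s.toNNReal ω ∂P := by
  rw [← integral_intervalIntegral_swap (hp.integrable_prod_integratedIntensity_mul hν hν2 t),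
    ← integral_const_mul]
  refine integral_congr_ae ?_
  filter_upwards [hp.ae_isGoodPath] with ω hω
  exact hω.integratedIntensity_sq t

end Second

end IsLinearSelfExciting

/-! ### Closed forms of the moments -/

theorem hasDerivAt_exp_mul (c t : ℝ) :
    HasDerivAt (fun t => Real.exp (c * t)) (c * Real.exp (c * t)) t := by
  have := ((hasDerivAt_id t).const_mul c).exp
  simpa [mul_comm] using this

/-- Exponential polynomials of the form occurring in the second moment of the integrated
intensity, and their derivatives. -/
theorem hasDerivAt_expPoly (k₀ k₁ k₂ C₀ C₁ C₂ ρ t : ℝ) :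
    HasDerivAt (fun t => k₀ + k₁ * t + k₂ * t ^ 2 + (C₀ + C₁ * t) * Real.exp (ρ * t)
      + C₂ * Real.exp (2 * ρ * t))
      (k₁ + 2 * k₂ * t + 0 * t ^ 2 + ((ρ * C₀ + C₁) + ρ * C₁ * t) * Real.exp (ρ * t)
        + 2 * ρ * C₂ * Real.exp (2 * ρ * t)) t := by
  have h1 := (((hasDerivAt_const t k₀).add ((hasDerivAt_id t).const_mul k₁)).add
    ((hasDerivAt_pow 2 t).const_mul k₂)).add
    (((hasDerivAt_const t C₀).add ((hasDerivAt_id t).const_mul C₁)).mul (hasDerivAt_exp_mul ρ t))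
  have h2 := h1.add ((hasDerivAt_exp_mul (2 * ρ) t).const_mul C₂)
  refine h2.congr_deriv ?_
  simp
  ring

namespace IsLinearSelfExciting

variable [IsProbabilityMeasure P] [IsProbabilityMeasure ν]
  (hp : IsLinearSelfExciting P 𝓕 α lam₀ β init ν T X lam)
  (hν : Integrable (fun x : ℝ => x) ν)
  {ρ A m₀ m₁ v₀ v₁ v₂ : ℝ}
  (hρ : ρ = β * (∫ x, x ∂ν) - α) (hρ0 : ρ ≠ 0)
  (hm₀ : m₀ = -(α * lam₀ / ρ)) (hm₁ : m₁ = α * lam₀ / ρ + init)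
include hp hν hρ hρ0 hm₀ hm₁

theorem integral_intensity (t : ℝ≥0) :
    ∫ ω, lam t ω ∂P = m₀ + m₁ * Real.exp (ρ * t) := by
  have key := eq_of_eq_add_integral (u := fun s => ∫ ω, lam s.toNNReal ω ∂P)
    (φ := fun s => m₀ + m₁ * Real.exp (ρ * s)) (g := fun _ => α * lam₀) (c := init) (κ := ρ)
    (fun s hs => by
      lift s to ℝ≥0 using hs
      exact intervalIntegrable_integral (hp.integrable_prod_intensity hν s))
    continuous_const
    (fun s hs => by
      lift s to ℝ≥0 using hs
      rw [Real.toNNReal_coe, hp.integral_intensity_eq hν s, hρ])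
    (fun s => by
      refine (((hasDerivAt_exp_mul ρ s).const_mul m₁).const_add m₀).congr_deriv ?_
      rw [hm₀]
      field_simp
      ring)
    (by simp [hm₀, hm₁]) t t.coe_nonneg
  simpa using key

variable (hν2 : Integrable (fun x : ℝ => x ^ 2) ν)
  (hA : A = 2 * α * lam₀ + β ^ 2 * ∫ x, x ^ 2 ∂ν)
  (hv₀ : v₀ = A * α * lam₀ / (2 * ρ ^ 2))
  (hv₁ : v₁ = -(A / ρ) * (α * lam₀ / ρ + init))
  (hv₂ : v₂ = A / (2 * ρ ^ 2) * (α * lam₀ + 2 * ρ * init) + init ^ 2)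
include hν2 hA hv₀ hv₁ hv₂

theorem integral_intensity_sq (t : ℝ≥0) :
    ∫ ω, lam t ω ^ 2 ∂P = v₀ + v₁ * Real.exp (ρ * t) + v₂ * Real.exp (2 * ρ * t) := by
  have key := eq_of_eq_add_integral (u := fun s => ∫ ω, lam s.toNNReal ω ^ 2 ∂P)
    (φ := fun s => v₀ + v₁ * Real.exp (ρ * s) + v₂ * Real.exp (2 * ρ * s))
    (g := fun s => A * (m₀ + m₁ * Real.exp (ρ * s))) (c := init ^ 2) (κ := 2 * ρ)
    (fun s hs => by
      lift s to ℝ≥0 using hs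
      exact intervalIntegrable_integral (hp.integrable_prod_intensity_sq hν hν2 s))
    (by fun_prop)
    (fun s hs => by
      lift s to ℝ≥0 using hs
      rw [Real.toNNReal_coe, hp.integral_intensity_sq_eq hν hν2 s, ← hA, ← hρ]
      congr 1
      refine intervalIntegral.integral_congr fun r hr => ?_
      rw [uIcc_of_le s.coe_nonneg] at hr
      rw [hp.integral_intensity hν hρ hρ0 hm₀ hm₁, Real.coe_toNNReal r hr.1])
    (fun s => by
      refine ((((hasDerivAt_exp_mul ρ s).const_mul v₁).const_add v₀).add
        ((hasDerivAt_exp_mul (2 * ρ) s).const_mul v₂)).congr_deriv ?_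
      rw [hm₀, hm₁, hv₀, hv₁]
      field_simp
      ring)
    (by
      simp only [mul_zero, Real.exp_zero, mul_one]
      rw [hv₀, hv₁, hv₂]
      field_simp
      ring) t t.coe_nonneg
  simpa using key

theorem integral_integratedIntensity_sq {k₀ k₁ k₂ C₀ C₁ C₂ : ℝ}
    (hk₀ : k₀ = (2 * m₀ * (m₀ - 2 * m₁) - 2 * v₀ + 2 * v₁ + v₂) / ρ ^ 2)
    (hk₁ : k₁ = (2 * m₀ * (m₀ - m₁) - 2 * v₀) / ρ)
    (hk₂ : k₂ = m₀ ^ 2)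
    (hC₀ : C₀ = 2 * (m₀ * (2 * m₁ - m₀) + v₀ - v₁ - v₂) / ρ ^ 2)
    (hC₁ : C₁ = 2 * (v₁ - m₀ * m₁) / ρ)
    (hC₂ : C₂ = v₂ / ρ ^ 2) (t : ℝ≥0) :
    ∫ ω, integratedIntensity lam t ω ^ 2 ∂P =
      k₀ + k₁ * t + k₂ * (t : ℝ) ^ 2 + (C₀ + C₁ * t) * Real.exp (ρ * t)
        + C₂ * Real.exp (2 * ρ * t) := by
  have hαm : α * lam₀ = -(ρ * m₀) := by rw [hm₀]; field_simp
  have hm : ∀ s : ℝ≥0, ∫ ω, integratedIntensity lam s ω ∂P =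
      m₀ * s + m₁ / ρ * (Real.exp (ρ * s) - 1) := by
    intro s
    rw [hp.integral_integratedIntensity hν s]
    have : ∀ r ∈ uIcc (0 : ℝ) s, ∫ ω, lam r.toNNReal ω ∂P = m₀ + m₁ * Real.exp (ρ * r) := by
      intro r hr
      rw [uIcc_of_le s.coe_nonneg] at hr
      rw [hp.integral_intensity hν hρ hρ0 hm₀ hm₁, Real.coe_toNNReal r hr.1]
    rw [intervalIntegral.integral_congr this, intervalIntegral.integral_eq_sub_of_hasDerivAt
      (f := fun r => m₀ * r + m₁ / ρ * (Real.exp (ρ * r) - 1)) (fun r _ => by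
        refine (((hasDerivAt_id r).const_mul m₀).add
          (((hasDerivAt_exp_mul ρ r).sub_const 1).const_mul (m₁ / ρ))).congr_deriv ?_
        field_simp) (Continuous.intervalIntegrable (by fun_prop) _ _)]
    simp
  -- the derivative of the claimed second moment is twice the claimed value of `E[Λ λ]`
  have hp' : ∀ s : ℝ, 0 ≤ s → ∫ ω, integratedIntensity lam s.toNNReal ω * lam s.toNNReal ω ∂P =
      (k₁ + 2 * k₂ * s + 0 * s ^ 2 + ((ρ * C₀ + C₁) + ρ * C₁ * s) * Real.exp (ρ * s)
        + 2 * ρ * C₂ * Real.exp (2 * ρ * s)) / 2 := by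
    refine eq_of_eq_add_integral
      (g := fun s => (v₀ + v₁ * Real.exp (ρ * s) + v₂ * Real.exp (2 * ρ * s)) +
        α * lam₀ * (m₀ * s + m₁ / ρ * (Real.exp (ρ * s) - 1))) (c := 0) (κ := ρ)
      (fun s hs => ?_) (by fun_prop) (fun s hs => ?_) (fun s => ?_) ?_
    · lift s to ℝ≥0 using hs
      exact intervalIntegrable_integral (hp.integrable_prod_integratedIntensity_mul hν hν2 s)
    · lift s to ℝ≥0 using hs
      rw [Real.toNNReal_coe, hp.integral_integratedIntensity_mul_eq hν hν2 s, ← hρ, zero_add]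
      refine intervalIntegral.integral_congr fun r hr => ?_
      rw [uIcc_of_le s.coe_nonneg] at hr
      rw [hp.integral_intensity_sq hν hρ hρ0 hm₀ hm₁ hν2 hA hv₀ hv₁ hv₂, hm,
        Real.coe_toNNReal r hr.1]
    · refine ((hasDerivAt_expPoly k₁ (2 * k₂) 0 (ρ * C₀ + C₁) (ρ * C₁) (2 * ρ * C₂) ρ s).div_const
        2).congr_deriv ?_
      rw [hαm, hk₁, hk₂, hC₀, hC₁, hC₂]
      field_simp
      ring
    · simp only [mul_zero, Real.exp_zero, mul_one]
      rw [hk₁, hC₀, hC₁, hC₂]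
      field_simp
      ring
  rw [hp.integral_integratedIntensity_sq_eq hν hν2, ← intervalIntegral.integral_const_mul]
  have : ∀ r ∈ uIcc (0 : ℝ) t,
      2 * ∫ ω, integratedIntensity lam r.toNNReal ω * lam r.toNNReal ω ∂P =
      k₁ + 2 * k₂ * r + 0 * r ^ 2 + ((ρ * C₀ + C₁) + ρ * C₁ * r) * Real.exp (ρ * r)
        + 2 * ρ * C₂ * Real.exp (2 * ρ * r) := by
    intro r hr
    rw [uIcc_of_le t.coe_nonneg] at hr
    rw [hp' r hr.1]
    ring
  rw [intervalIntegral.integral_congr this, intervalIntegral.integral_eq_sub_of_hasDerivAt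
    (fun r _ => hasDerivAt_expPoly k₀ k₁ k₂ C₀ C₁ C₂ ρ r)
    (Continuous.intervalIntegrable (by fun_prop) _ _)]
  have h0 : k₀ + C₀ + C₂ = 0 := by
    rw [hk₀, hC₀, hC₂]
    field_simp
    ring
  simp only [mul_zero, Real.exp_zero, mul_one]
  linear_combination -h0

end IsLinearSelfExciting

end SelfExciting

theorem mainTheorem3 {Ω : Type*} {mΩ : MeasurableSpace Ω} (P : Measure Ω) [IsProbabilityMeasure P]
    (𝓕 : Filtration ℝ≥0 mΩ) (α lam₀ β init : ℝ) (ν : Measure ℝ) [IsProbabilityMeasure ν]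
    (T : ℕ → Ω → WithTop ℝ≥0) (X : ℕ → Ω → ℝ) (lam : ℝ≥0 → Ω → ℝ)
    (hproc : SelfExciting.IsLinearSelfExciting P 𝓕 α lam₀ β init ν T X lam)
    (hν₁ : Integrable (fun x : ℝ => x) ν)
    (ρ A m₀ m₁ v₀ v₁ v₂ k₀ k₁ k₂ C₀ C₁ C₂ : ℝ)
    (hρ : ρ = β * (∫ x, x ∂ν) - α) (hρ0 : ρ ≠ 0)
    (hA : A = 2 * α * lam₀ + β ^ 2 * ∫ x, x ^ 2 ∂ν)
    (hm₀ : m₀ = -(α * lam₀ / ρ))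
    (hm₁ : m₁ = α * lam₀ / ρ + init)
    (hv₀ : v₀ = A * α * lam₀ / (2 * ρ ^ 2))
    (hv₁ : v₁ = -(A / ρ) * (α * lam₀ / ρ + init))
    (hv₂ : v₂ = A / (2 * ρ ^ 2) * (α * lam₀ + 2 * ρ * init) + init ^ 2)
    (hk₀ : k₀ = (2 * m₀ * (m₀ - 2 * m₁) - 2 * v₀ + 2 * v₁ + v₂) / ρ ^ 2)
    (hk₁ : k₁ = (2 * m₀ * (m₀ - m₁) - 2 * v₀) / ρ)
    (hk₂ : k₂ = m₀ ^ 2)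
    (hC₀ : C₀ = 2 * (m₀ * (2 * m₁ - m₀) + v₀ - v₁ - v₂) / ρ ^ 2)
    (hC₁ : C₁ = 2 * (v₁ - m₀ * m₁) / ρ)
    (hC₂ : C₂ = v₂ / ρ ^ 2) :
    (∀ t : ℝ≥0, Integrable (lam t) P ∧
      ∫ ω, lam t ω ∂P = m₀ + m₁ * Real.exp (ρ * t)) ∧
    (Integrable (fun x : ℝ => x ^ 2) ν →
      (∀ t : ℝ≥0, Integrable (fun ω => lam t ω ^ 2) P ∧
        ∫ ω, lam t ω ^ 2 ∂P = v₀ + v₁ * Real.exp (ρ * t) + v₂ * Real.exp (2 * ρ * t)) ∧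
      (∀ t : ℝ≥0, Integrable (fun ω => SelfExciting.integratedIntensity lam t ω ^ 2) P ∧
        ∫ ω, SelfExciting.integratedIntensity lam t ω ^ 2 ∂P =
          k₀ + k₁ * t + k₂ * (t : ℝ) ^ 2 + (C₀ + C₁ * t) * Real.exp (ρ * t)
            + C₂ * Real.exp (2 * ρ * t))) := by
  refine ⟨fun t => ⟨hproc.integrable_intensity hν₁ t,
    hproc.integral_intensity hν₁ hρ hρ0 hm₀ hm₁ t⟩, fun hν₂ => ⟨fun t =>
    ⟨hproc.integrable_intensity_sq hν₁ hν₂ t,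
      hproc.integral_intensity_sq hν₁ hρ hρ0 hm₀ hm₁ hν₂ hA hv₀ hv₁ hv₂ t⟩, fun t =>
    ⟨hproc.integrable_integratedIntensity_sq hν₁ hν₂ t,
      hproc.integral_integratedIntensity_sq hν₁ hρ hρ0 hm₀ hm₁ hν₂ hA hv₀ hv₁ hv₂
        hk₀ hk₁ hk₂ hC₀ hC₁ hC₂ t⟩⟩⟩
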